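/- Let $\Bbbk$ be an algebraically closed field of characteristic $0$, let $n \geqslant 2$, let $\omega \in \Bbbk$ be a primitive $n$th root of unity, and let $\sqrt{\omega} \in \Bbbk$ be a square root of $\omega$ whose multiplicative order is $n$. Let $T_n = \Bbbk\langle x,g \mid g^n-1,\ x^n,\ gx-\omega xg\rangle$ be the Taft algebra, with $\Delta(g)=g\otimes g$, $\Delta(x)=g\otimes x+x\otimes 1$, $\varepsilon(g)=1$, $\varepsilon(x)=0$. Let $0 \leqslant k \leqslant n-1$, let $q \in \Bbbk^\times$, put $$\alpha = \omega^{-(k+1)}(1+\sqrt{\omega}), \qquad \beta = -\omega^{-2(k+1)}\sqrt{\omega},$$ and let $A = A(\alpha,\beta)$ be the down-up algebra generated by $u,v$ subject to $v^2u = \alpha vuv+\beta uv^2$ and $vu^2=\alpha uvu+\beta u^2v$, graded by $\deg u=\deg v=1$. Suppose that $T_n$ acts on $A$ (making $A$ a left $T_n$-module algebra) with $$g\cdot u=\omega^{k+1}u,\quad g\cdot v=\omega^k v,\quad x\cdot u=0,\quad x\cdot v=q\,u .$$ Let $A^x=\{a\in A \mid x\cdot a=0\}$, a subalgebra of $A$,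 and let $z = vu-\omega^{-(k+1)}uv$. Then $A^x$ is generated as a $\Bbbk$-algebra by $u$, $z$ and $v^n$, and these elements satisfy $$v^nu=uv^n,\qquad zu=\omega^{-(k+1)}\sqrt{\omega}\;uz,\qquad v^nz=zv^n .$$ Moreover $A^x$ is a skew polynomial ring in $u,z,v^n$: the algebra homomorphism from the algebra on generators $x_0,x_1,x_2$ with relations $x_1x_0=\omega^{-(k+1)}\sqrt{\omega}\,x_0x_1$, $x_2x_0=x_0x_2$, $x_2x_1=x_1x_2$ to $A^x$ that sends $x_0,x_1,x_2$ to $u,z,v^n$, respectively, is an isomorphism. In particular $A^x$, with the grading induced from $A$, is Artin--Schelter regular. -/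

import Mathlib

open scoped TensorProduct

universe u v w

/-! ### Actions of Hopf algebras on algebras -/

/-- A (left) action of the bialgebra `H` on the algebra `A`, that is, a left `H`-module algebra
structure on `A`: a representation of `H` on `A` such that `h · 1 = ε(h) 1` and
`h · (a b) = ∑ (h₁ · a) (h₂ · b)`. (No axiom involves the antipode of `H`.) -/
structure HopfAction (𝕜 : Type u) (H : Type v) (A : Type w) [Field 𝕜] [Ring H] [Bialgebra 𝕜 H]
    [Ring A] [Algebra 𝕜 A] where
  act : H →ₐ[𝕜] Module.End 𝕜 A
  act_one : ∀ h : H, act h 1 = (Coalgebra.counit (R := 𝕜) h) • (1 : A)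
  act_mul : ∀ (h : H) (a b : A), act h (a * b) =
    LinearMap.mul' 𝕜 A
      (TensorProduct.map (act.toLinearMap.flip a) (act.toLinearMap.flip b)
        (Coalgebra.comul (R := 𝕜) h))

/-! ### The Taft algebras -/

section Taft

variable {𝕜 : Type u} [Field 𝕜]

/-- The Gaussian binomial coefficients, through their Pascal recursion. -/
def gaussCoeff (q : 𝕜) : ℕ → ℕ → 𝕜
  | _, 0 => 1
  | 0, _ + 1 => 0
  | m + 1, i + 1 => gaussCoeff q m i + q ^ (i + 1) * gaussCoeff q m (i + 1)

theorem gaussCoeff_zero_right (q : 𝕜) (m : ℕ) : gaussCoeff q m 0 = 1 := by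
  cases m <;> rfl

theorem gaussCoeff_succ_succ (q : 𝕜) (m i : ℕ) : gaussCoeff q (m + 1) (i + 1) =
    gaussCoeff q m i + q ^ (i + 1) * gaussCoeff q m (i + 1) := rfl

theorem gaussCoeff_of_lt (q : 𝕜) : ∀ {m i : ℕ}, m < i → gaussCoeff q m i = 0
  | _, 0, h => absurd h (Nat.not_lt_zero _)
  | 0, _ + 1, _ => rfl
  | m + 1, i + 1, h => by
      rw [gaussCoeff_succ_succ, gaussCoeff_of_lt q (show m < i by omega),
        gaussCoeff_of_lt q (show m < i + 1 by omega)]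
      simp

theorem gaussCoeff_self (q : 𝕜) : ∀ m : ℕ, gaussCoeff q m m = 1
  | 0 => rfl
  | m + 1 => by
      rw [gaussCoeff_succ_succ, gaussCoeff_self q m, gaussCoeff_of_lt q (Nat.lt_succ_self m)]
      simp

theorem gaussCoeff_absorb (q : 𝕜) (m : ℕ) : ∀ i : ℕ,
    (1 - q ^ (i + 1)) * gaussCoeff q (m + 1) (i + 1) = (1 - q ^ (m + 1)) * gaussCoeff q m i := by
  induction m with
  | zero =>
      intro i
      cases i with
      | zero => simp [gaussCoeff]
      | succ i => simp [gaussCoeff]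
  | succ m ih =>
      intro i
      rw [gaussCoeff_succ_succ q (m + 1) i]
      have h1 := ih i
      cases i with
      | zero =>
          simp only [gaussCoeff_zero_right] at h1 ⊢
          linear_combination q * h1
      | succ i =>
          have h2 := ih i
          have h3 := gaussCoeff_succ_succ q m i
          linear_combination q ^ (i + 2) * h1 + q * h2 - (q - q ^ (m + 2)) * h3

theorem gaussCoeff_primitive {q : 𝕜} {n : ℕ} (hq : IsPrimitiveRoot q n) {i : ℕ}
    (h0 : 0 < i) (hi : i < n) : gaussCoeff q n i = 0 := by
  obtain ⟨i, rfl⟩ := Nat.exists_eq_succ_of_ne_zero h0.ne'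
  obtain ⟨n, rfl⟩ := Nat.exists_eq_succ_of_ne_zero (show n ≠ 0 by omega)
  have h := gaussCoeff_absorb q n i
  have hn : q ^ (n + 1) = 1 := hq.pow_eq_one
  rw [hn, sub_self, zero_mul] at h
  refine (mul_eq_zero.mp h).resolve_left ?_
  intro h'
  exact hq.pow_ne_one_of_pos_of_lt (Nat.succ_ne_zero i) hi (sub_eq_zero.mp h').symm

theorem qcomm_pow {B : Type w} [Ring B] [Algebra 𝕜 B] {q : 𝕜} {a b : B}
    (hab : a * b = q • (b * a)) (i : ℕ) : a * b ^ i = q ^ i • (b ^ i * a) := by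
  induction i with
  | zero => simp
  | succ i ih =>
      rw [pow_succ, ← mul_assoc, ih, smul_mul_assoc, mul_assoc, hab, mul_smul_comm, smul_smul,
        ← mul_assoc, pow_succ]

theorem q_binomial {B : Type w} [Ring B] [Algebra 𝕜 B] {q : 𝕜} {a b : B}
    (hab : a * b = q • (b * a)) (m : ℕ) : (a + b) ^ m =
      ∑ i ∈ Finset.range (m + 1), gaussCoeff q m i • (b ^ i * a ^ (m - i)) := by
  induction m with
  | zero => simp [gaussCoeff]
  | succ m ih =>
      rw [pow_succ', ih, add_mul, Finset.mul_sum, Finset.mul_sum,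
        Finset.sum_range_succ' _ (m + 1)]
      have e1 : ∑ i ∈ Finset.range (m + 1), a * gaussCoeff q m i • (b ^ i * a ^ (m - i)) =
          ∑ i ∈ Finset.range (m + 1),
            (q ^ (i + 1) * gaussCoeff q m (i + 1)) • (b ^ (i + 1) * a ^ (m - i)) +
          a ^ (m + 1) := by
        have e2 : ∀ i ∈ Finset.range (m + 1), a * gaussCoeff q m i • (b ^ i * a ^ (m - i)) =
            (q ^ i * gaussCoeff q m i) • (b ^ i * a ^ (m + 1 - i)) := by
          intro i hi
          have : m + 1 - i = (m - i) + 1 := by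
            have := Finset.mem_range.mp hi
            omega
          rw [mul_smul_comm, ← mul_assoc, qcomm_pow hab, smul_mul_assoc, smul_smul, mul_assoc,
            this, pow_succ' a (m - i), mul_comm (q ^ i)]
        rw [Finset.sum_congr rfl e2, Finset.sum_range_succ' _ m, Finset.sum_range_succ _ m,
          gaussCoeff_of_lt q (Nat.lt_succ_self m)]
        simp [gaussCoeff_zero_right]
      rw [e1]
      simp only [gaussCoeff_succ_succ, gaussCoeff_zero_right, add_smul, Finset.sum_add_distrib,
        mul_smul_comm, ← mul_assoc, ← pow_succ', Nat.add_sub_add_right, pow_zero, one_mul,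
        one_smul, Nat.sub_zero]
      abel

theorem q_binomial_primitive {B : Type w} [Ring B] [Algebra 𝕜 B] {q : 𝕜} {a b : B} {n : ℕ}
    (hn : 0 < n) (hq : IsPrimitiveRoot q n) (hab : a * b = q • (b * a)) :
    (a + b) ^ n = a ^ n + b ^ n := by
  obtain ⟨n, rfl⟩ := Nat.exists_eq_succ_of_ne_zero hn.ne'
  rw [q_binomial hab, Finset.sum_range_succ, Finset.sum_range_succ']
  rw [Finset.sum_eq_zero]
  · simp [gaussCoeff_self, gaussCoeff_zero_right]
  · intro i hi
    have := Finset.mem_range.mp hi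
    rw [gaussCoeff_primitive hq (Nat.succ_pos i) (by omega), zero_smul]

/-- The two generators of a Taft algebra. -/
inductive TaftGen
  | g
  | x

/-- The defining relations `gⁿ = 1`, `xⁿ = 0`, `g x = ω x g` of the Taft algebra. -/
inductive TaftRel (n : ℕ) (ω : 𝕜) : FreeAlgebra 𝕜 TaftGen → FreeAlgebra 𝕜 TaftGen → Prop
  | g_pow : TaftRel n ω (FreeAlgebra.ι 𝕜 TaftGen.g ^ n) 1
  | x_pow : TaftRel n ω (FreeAlgebra.ι 𝕜 TaftGen.x ^ n) 0
  | g_x : TaftRel n ω (FreeAlgebra.ι 𝕜 TaftGen.g * FreeAlgebra.ι 𝕜 TaftGen.x)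
      (ω • (FreeAlgebra.ι 𝕜 TaftGen.x * FreeAlgebra.ι 𝕜 TaftGen.g))

/-- The Taft algebra `T_n = 𝕜⟨x, g | gⁿ - 1, xⁿ, g x - ω x g⟩`, for `n ≥ 2` and a primitive
`n`-th root of unity `ω`. -/
def Taft {n : ℕ} {ω : 𝕜} (_hn : 2 ≤ n) (_hω : IsPrimitiveRoot ω n) : Type u :=
  RingQuot (TaftRel n ω)

namespace Taft

variable {n : ℕ} {ω : 𝕜} (hn : 2 ≤ n) (hω : IsPrimitiveRoot ω n)

instance instRing : Ring (Taft hn hω) := inferInstanceAs (Ring (RingQuot (TaftRel n ω)))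

instance instAlgebra : Algebra 𝕜 (Taft hn hω) :=
  inferInstanceAs (Algebra 𝕜 (RingQuot (TaftRel n ω)))

/-- The quotient map from the free algebra. -/
def mk : FreeAlgebra 𝕜 TaftGen →ₐ[𝕜] Taft hn hω := RingQuot.mkAlgHom 𝕜 (TaftRel n ω)

/-- The generator `g`. -/
def g : Taft hn hω := mk hn hω (FreeAlgebra.ι 𝕜 TaftGen.g)

/-- The generator `x`. -/
def x : Taft hn hω := mk hn hω (FreeAlgebra.ι 𝕜 TaftGen.x)

theorem mk_rel {a b : FreeAlgebra 𝕜 TaftGen} (h : TaftRel n ω a b) :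
    mk hn hω a = mk hn hω b :=
  RingQuot.mkAlgHom_rel 𝕜 h

theorem g_pow : g hn hω ^ n = 1 := by
  simpa [g] using mk_rel hn hω TaftRel.g_pow

theorem x_pow : x hn hω ^ n = 0 := by
  simpa [x] using mk_rel hn hω TaftRel.x_pow

theorem g_mul_x : g hn hω * x hn hω = ω • (x hn hω * g hn hω) := by
  simpa [g, x] using mk_rel hn hω TaftRel.g_x

/-- The universal property of the presentation. -/
def lift {B : Type w} [Ring B] [Algebra 𝕜 B] (G X : B) (h1 : G ^ n = 1) (h2 : X ^ n = 0)
    (h3 : G * X = ω • (X * G)) : Taft hn hω →ₐ[𝕜] B :=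
  RingQuot.liftAlgHom 𝕜 ⟨FreeAlgebra.lift 𝕜 (fun t => TaftGen.casesOn t G X), by
    rintro _ _ (_ | _ | _)
    · simpa using h1
    · simpa using h2
    · simpa using h3⟩

theorem lift_g {B : Type w} [Ring B] [Algebra 𝕜 B] (G X : B) (h1 : G ^ n = 1) (h2 : X ^ n = 0)
    (h3 : G * X = ω • (X * G)) : lift hn hω G X h1 h2 h3 (g hn hω) = G :=
  (RingQuot.liftAlgHom_mkAlgHom_apply (S := 𝕜) _ _ _).trans
    (FreeAlgebra.lift_ι_apply _ _)

theorem lift_x {B : Type w} [Ring B] [Algebra 𝕜 B] (G X : B) (h1 : G ^ n = 1) (h2 : X ^ n = 0)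
    (h3 : G * X = ω • (X * G)) : lift hn hω G X h1 h2 h3 (x hn hω) = X :=
  (RingQuot.liftAlgHom_mkAlgHom_apply (S := 𝕜) _ _ _).trans
    (FreeAlgebra.lift_ι_apply _ _)

theorem hom_ext {B : Type w} [Semiring B] [Algebra 𝕜 B] {φ ψ : Taft hn hω →ₐ[𝕜] B}
    (h1 : φ (g hn hω) = ψ (g hn hω)) (h2 : φ (x hn hω) = ψ (x hn hω)) : φ = ψ := by
  refine RingQuot.ringQuot_ext' (S := 𝕜) φ ψ ?_
  refine FreeAlgebra.hom_ext (funext fun t => ?_)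
  cases t
  · exact h1
  · exact h2

/-- The comultiplication: `Δ(g) = g ⊗ g`, `Δ(x) = g ⊗ x + x ⊗ 1`. -/
noncomputable def comulHom : Taft hn hω →ₐ[𝕜] Taft hn hω ⊗[𝕜] Taft hn hω :=
  lift hn hω (g hn hω ⊗ₜ[𝕜] g hn hω) (g hn hω ⊗ₜ[𝕜] x hn hω + x hn hω ⊗ₜ[𝕜] 1)
    (by rw [Algebra.TensorProduct.tmul_pow, g_pow, Algebra.TensorProduct.one_def])
    (by
      rw [q_binomial_primitive (by omega) hω]
      · simp [Algebra.TensorProduct.tmul_pow, x_pow]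
      · simp [g_mul_x, TensorProduct.smul_tmul'])
    (by
      simp [mul_add, add_mul, g_mul_x, TensorProduct.smul_tmul', TensorProduct.tmul_smul])

/-- The counit: `ε(g) = 1`, `ε(x) = 0`. -/
def counitHom : Taft hn hω →ₐ[𝕜] 𝕜 :=
  lift hn hω 1 0 (one_pow n) (zero_pow (by omega)) (by simp)

theorem comulHom_g : comulHom hn hω (g hn hω) = g hn hω ⊗ₜ[𝕜] g hn hω := lift_g ..

theorem comulHom_x : comulHom hn hω (x hn hω) =
    g hn hω ⊗ₜ[𝕜] x hn hω + x hn hω ⊗ₜ[𝕜] 1 := lift_x ..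

theorem counitHom_g : counitHom hn hω (g hn hω) = 1 := lift_g ..

theorem counitHom_x : counitHom hn hω (x hn hω) = 0 := lift_x ..

/-- The Taft algebra with `g` grouplike and `x` a `(g, 1)`-skew primitive element. -/
noncomputable instance instBialgebra : Bialgebra 𝕜 (Taft hn hω) :=
  Bialgebra.ofAlgHom (comulHom hn hω) (counitHom hn hω)
    (hom_ext hn hω (by simp [comulHom_g])
      (by simp [comulHom_g, comulHom_x, TensorProduct.add_tmul, TensorProduct.tmul_add,
            Algebra.TensorProduct.one_def, add_assoc]))
    (hom_ext hn hω (by simp [comulHom_g, counitHom_g])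
      (by simp [comulHom_x, counitHom_g, counitHom_x]))
    (hom_ext hn hω (by simp [comulHom_g, counitHom_g])
      (by simp [comulHom_x, counitHom_x]))

theorem comul_x : Coalgebra.comul (R := 𝕜) (x hn hω) =
    g hn hω ⊗ₜ[𝕜] x hn hω + x hn hω ⊗ₜ[𝕜] 1 := comulHom_x hn hω

theorem counit_x : Coalgebra.counit (R := 𝕜) (x hn hω) = 0 := counitHom_x hn hω

variable {hn hω}

theorem act_x_mul {A : Type w} [Ring A] [Algebra 𝕜 A] (T : HopfAction 𝕜 (Taft hn hω) A)
    (a b : A) : T.act (x hn hω) (a * b) =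
      T.act (g hn hω) a * T.act (x hn hω) b + T.act (x hn hω) a * b := by
  rw [T.act_mul, comul_x]
  simp

/-- The subalgebra `A^x = {a ∈ A | x · a = 0}` of `x`-invariants, for an action of the Taft
algebra on `A`. -/
def xInvariants {A : Type w} [Ring A] [Algebra 𝕜 A] (T : HopfAction 𝕜 (Taft hn hω) A) :
    Subalgebra 𝕜 A where
  carrier := {a | T.act (x hn hω) a = 0}
  mul_mem' := by
    intro a b ha hb
    simp only [Set.mem_ofPred_eq] at ha hb ⊢
    rw [act_x_mul, ha, hb, mul_zero, zero_mul, add_zero]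
  add_mem' := by
    intro a b ha hb
    simp only [Set.mem_ofPred_eq] at ha hb ⊢
    rw [map_add, ha, hb, add_zero]
  algebraMap_mem' := by
    intro c
    simp only [Set.mem_ofPred_eq]
    rw [Algebra.algebraMap_eq_smul_one, map_smul, T.act_one, counit_x, zero_smul, smul_zero]

end Taft

end Taft

/-! ### Down-up algebras and skew polynomial rings -/

section Algebras

variable {𝕜 : Type u} [Field 𝕜]

/-- The two generators of a down-up algebra. -/
inductive DownUpGen
  | u
  | v

/-- The relations `v²u = α vuv + β uv²` and `vu² = α uvu + β u²v`. -/
inductive DownUpRel (α β : 𝕜) : FreeAlgebra 𝕜 DownUpGen → FreeAlgebra 𝕜 DownUpGen → Prop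
  | vvu : DownUpRel α β
      (FreeAlgebra.ι 𝕜 DownUpGen.v ^ 2 * FreeAlgebra.ι 𝕜 DownUpGen.u)
      (α • (FreeAlgebra.ι 𝕜 DownUpGen.v * FreeAlgebra.ι 𝕜 DownUpGen.u *
          FreeAlgebra.ι 𝕜 DownUpGen.v) +
        β • (FreeAlgebra.ι 𝕜 DownUpGen.u * FreeAlgebra.ι 𝕜 DownUpGen.v ^ 2))
  | vuu : DownUpRel α β
      (FreeAlgebra.ι 𝕜 DownUpGen.v * FreeAlgebra.ι 𝕜 DownUpGen.u ^ 2)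
      (α • (FreeAlgebra.ι 𝕜 DownUpGen.u * FreeAlgebra.ι 𝕜 DownUpGen.v *
          FreeAlgebra.ι 𝕜 DownUpGen.u) +
        β • (FreeAlgebra.ι 𝕜 DownUpGen.u ^ 2 * FreeAlgebra.ι 𝕜 DownUpGen.v))

/-- The graded down-up algebra `A(α, β)`. -/
abbrev DownUp (α β : 𝕜) : Type u := RingQuot (DownUpRel α β)

namespace DownUp

variable (α β : 𝕜)

/-- The generator `u`. -/
def u : DownUp α β := RingQuot.mkAlgHom 𝕜 (DownUpRel α β) (FreeAlgebra.ι 𝕜 DownUpGen.u)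

/-- The generator `v`. -/
def v : DownUp α β := RingQuot.mkAlgHom 𝕜 (DownUpRel α β) (FreeAlgebra.ι 𝕜 DownUpGen.v)

/-- The grading with `deg u = deg v = 1`: the piece of degree `i` is spanned by the words of
length `i` in `u` and `v`. -/
def grading (i : ℕ) : Submodule 𝕜 (DownUp α β) := (Submodule.span 𝕜 {u α β, v α β}) ^ i

end DownUp

/-- The relations `x_j x_i = q_{ij} x_i x_j` for `i < j`. -/
inductive SkewPolyRel {m : ℕ} (q : Matrix (Fin m) (Fin m) 𝕜) :
    FreeAlgebra 𝕜 (Fin m) → FreeAlgebra 𝕜 (Fin m) → Prop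
  | comm (i j : Fin m) (hij : i < j) : SkewPolyRel q
      (FreeAlgebra.ι 𝕜 j * FreeAlgebra.ι 𝕜 i)
      (q i j • (FreeAlgebra.ι 𝕜 i * FreeAlgebra.ι 𝕜 j))

/-- The skew polynomial ring `𝕜_q[x_0, …, x_{m-1}]`, generated by the `x_i` subject to
`x_j x_i = q_{ij} x_i x_j` for `i < j`. -/
abbrev SkewPolyRing {m : ℕ} (q : Matrix (Fin m) (Fin m) 𝕜) : Type u := RingQuot (SkewPolyRel q)

/-- The variable `x_i` of a skew polynomial ring. -/
def SkewPolyRing.X {m : ℕ} (q : Matrix (Fin m) (Fin m) 𝕜) (i : Fin m) : SkewPolyRing q :=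
  RingQuot.mkAlgHom 𝕜 (SkewPolyRel q) (FreeAlgebra.ι 𝕜 i)

end Algebras

/-! ### Homological dimensions and Gelfand–Kirillov dimension -/

/-- The left global dimension of a ring: the supremum of the projective dimensions of its left
modules. -/
noncomputable def leftGlobalDimension (R : Type v) [Ring R] : WithBot ℕ∞ :=
  ⨆ M : ModuleCat.{v} R, CategoryTheory.projectiveDimension M

/-- The left self-injective dimension of a ring: the injective dimension of the ring as a left
module over itself. -/
noncomputable def leftSelfInjectiveDimension (R : Type v) [Ring R] : WithBot ℕ∞ :=
  CategoryTheory.injectiveDimension (ModuleCat.of R R)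

/-- The Gelfand–Kirillov dimension of an algebra: the supremum, over all finite-dimensional
subspaces `V`, of `limsup_m log dim (V⁰ + V¹ + ⋯ + Vᵐ) / log m`. -/
noncomputable def gkDim (𝕜 : Type u) (A : Type v) [Field 𝕜] [Ring A] [Algebra 𝕜 A] : EReal :=
  ⨆ V : {V : Submodule 𝕜 A // V.FG},
    Filter.limsup (fun m : ℕ => ((Real.log (Module.finrank 𝕜
      (⨆ i : Fin (m + 1), (V : Submodule 𝕜 A) ^ (i : ℕ) : Submodule 𝕜 A)) / Real.log m : ℝ) :
        EReal)) Filter.atTop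

/-! ### Artin–Schelter regular algebras -/

section ASRegular

variable {𝕜 : Type u} {A : Type v} [Field 𝕜] [Ring A] [Algebra 𝕜 A]

/-- The pieces `𝒜 i`, `i ∈ ℕ`, are a connected grading of `A`: they make `A` an `ℕ`-graded
algebra, and the piece of degree `0` is `𝕜`. -/
structure IsConnectedGrading (𝒜 : ℕ → Submodule 𝕜 A) : Prop where
  gradedMonoid : SetLike.GradedMonoid 𝒜
  isInternal : DirectSum.IsInternal 𝒜
  nontrivial : Nontrivial A
  zero_eq : 𝒜 0 = 1

/-- The grading of the opposite algebra. Right `A`-modules are left `Aᵐᵒᵖ`-modules. -/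
def opGrading (𝒜 : ℕ → Submodule 𝕜 A) (i : ℕ) : Submodule 𝕜 Aᵐᵒᵖ :=
  (𝒜 i).map (MulOpposite.opLinearEquiv 𝕜).toLinearMap

/-- The grading extended to all integers, by zero in negative degrees. -/
def intPiece (𝒜 : ℕ → Submodule 𝕜 A) (j : ℤ) : Submodule 𝕜 A :=
  if 0 ≤ j then 𝒜 j.toNat else ⊥

/-- The ideal `A_{≥ 1}`. It is written as the left ideal generated by the homogeneous elements of
positive degree, which is the sum of the pieces of positive degree. -/
def augIdeal (𝒜 : ℕ → Submodule 𝕜 A) : Ideal A :=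
  Ideal.span (⋃ i : ℕ, (𝒜 (i + 1) : Set A))

/-- The trivial left `A`-module `𝕜 = A / A_{≥ 1}`. -/
abbrev TrivialModule (𝒜 : ℕ → Submodule 𝕜 A) : Type v := A ⧸ augIdeal 𝒜

/-- The piece of degree `j` of the graded module `𝕜 = A / A_{≥ 1}`, the image of `A_j`. -/
def trivialPiece (𝒜 : ℕ → Submodule 𝕜 A) (j : ℤ) : Set (TrivialModule 𝒜) :=
  (augIdeal 𝒜).mkQ '' (intPiece 𝒜 j : Set A)

/-- A resolution `⋯ → F_1 → F_0 → 𝕜 → 0` of the trivial left module by finitely generated graded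
free left modules and maps of degree `0`. The module `F_i = A^(rank i)` is graded by giving the
basis vector `e_b` the degree `deg i b`. -/
structure GradedFreeResolution (𝒜 : ℕ → Submodule 𝕜 A) where
  rank : ℕ → ℕ
  deg : ∀ i : ℕ, Fin (rank i) → ℤ
  d : ∀ i : ℕ, (Fin (rank (i + 1)) → A) →ₗ[A] (Fin (rank i) → A)
  aug : (Fin (rank 0) → A) →ₗ[A] TrivialModule 𝒜
  d_homogeneous : ∀ (i : ℕ) (b : Fin (rank (i + 1))) (c : Fin (rank i)),
    d i (Pi.single b 1) c ∈ intPiece 𝒜 (deg (i + 1) b - deg i c)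
  aug_homogeneous : ∀ b : Fin (rank 0), aug (Pi.single b 1) ∈ trivialPiece 𝒜 (deg 0 b)
  aug_surjective : Function.Surjective aug
  exact_zero : Function.Exact (d 0) aug
  exact_succ : ∀ i : ℕ, Function.Exact (d (i + 1)) (d i)

namespace GradedFreeResolution

variable {𝒜 : ℕ → Submodule 𝕜 A} (F : GradedFreeResolution 𝒜)

/-- The term `Hom_A(F_i, A)` of the dual complex; it is a right `A`-module through the right
multiplication on `A`. -/
abbrev Cochain (i : ℕ) : Type v := (Fin (F.rank i) → A) →ₗ[A] A

/-- The differential `f ↦ f ∘ d` of the dual complex, a map of right `A`-modules. -/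
def δ (i : ℕ) : F.Cochain i →ₗ[Aᵐᵒᵖ] F.Cochain (i + 1) where
  toFun f := f.comp (F.d i)
  map_add' _ _ := rfl
  map_smul' _ _ := rfl

/-- The coboundaries in `Hom_A(F_i, A)`. -/
def coboundaries : ∀ i : ℕ, Submodule Aᵐᵒᵖ (F.Cochain i)
  | 0 => ⊥
  | i + 1 => LinearMap.range (F.δ i)

/-- The right `A`-module `Ext^i_A(𝕜, A)`: the cohomology of `Hom_A(F, A)`, that is, the image of
the cocycles in the quotient of `Hom_A(F_i, A)` by the coboundaries. Up to isomorphism of graded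
right modules it does not depend on the resolution `F`. -/
abbrev Ext (i : ℕ) : Submodule Aᵐᵒᵖ (F.Cochain i ⧸ F.coboundaries i) :=
  (LinearMap.ker (F.δ i)).map (F.coboundaries i).mkQ

/-- The piece of degree `j` of `Ext^i_A(𝕜, A)`: the classes of the cocycles `f : F_i → A` of
degree `j`, that is, with `f((F_i)_m) ⊆ A_{m + j}` for all `m`. -/
def extPiece (i : ℕ) (j : ℤ) : Set (F.Ext i) :=
  {y | ∃ f ∈ LinearMap.ker (F.δ i),
    (∀ b : Fin (F.rank i), f (Pi.single b 1) ∈ intPiece 𝒜 (F.deg i b + j)) ∧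
    (F.coboundaries i).mkQ f = y}

end GradedFreeResolution

/-- There are isomorphisms of graded right `A`-modules `Ext^i(_A 𝕜, _A A) ≅ 0` for `i ≠ d` and
`Ext^d(_A 𝕜, _A A) ≅ 𝕜[ℓ]_A`, where `𝕜[ℓ]_j = 𝕜_{ℓ + j}`. -/
def HasASExt (𝒜 : ℕ → Submodule 𝕜 A) (d : ℕ) (ℓ : ℤ) : Prop :=
  ∃ F : GradedFreeResolution 𝒜,
    (∀ i : ℕ, i ≠ d → Subsingleton (F.Ext i)) ∧
    ∃ e : F.Ext d ≃ₗ[Aᵐᵒᵖ] TrivialModule (opGrading 𝒜),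
      ∀ j : ℤ, e '' F.extPiece d j = trivialPiece (opGrading 𝒜) (ℓ + j)

/-- The connected graded algebra `A` is Artin–Schelter Gorenstein of dimension `d`. -/
structure IsASGorensteinOfDim (𝒜 : ℕ → Submodule 𝕜 A) (d : ℕ) : Prop where
  connected : IsConnectedGrading 𝒜
  injDim_left : leftSelfInjectiveDimension A = d
  injDim_right : leftSelfInjectiveDimension Aᵐᵒᵖ = d
  ext : ∃ ℓ : ℤ, HasASExt 𝒜 d ℓ ∧ HasASExt (opGrading 𝒜) d ℓ

/-- The connected graded algebra `A` is Artin–Schelter regular of dimension `d`. -/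
structure IsASRegularOfDim (𝒜 : ℕ → Submodule 𝕜 A) (d : ℕ) : Prop
    extends IsASGorensteinOfDim 𝒜 d where
  glDim_left : leftGlobalDimension A = d
  glDim_right : leftGlobalDimension Aᵐᵒᵖ = d
  gkDim_lt_top : gkDim 𝕜 A < ⊤

/-- The connected graded algebra `A` is Artin–Schelter regular. -/
def IsASRegular (𝒜 : ℕ → Submodule 𝕜 A) : Prop := ∃ d : ℕ, IsASRegularOfDim 𝒜 d

end ASRegular

/-- The grading `B_i = B ∩ A_i` of a subalgebra `B` of a graded algebra `A`. -/
def inducedGrading {𝕜 : Type u} {A : Type v} [Field 𝕜] [Ring A] [Algebra 𝕜 A]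
    (𝒜 : ℕ → Submodule 𝕜 A) (B : Subalgebra 𝕜 A) (i : ℕ) : Submodule 𝕜 B :=
  (𝒜 i).comap B.val.toLinearMap

/-!
Put `p = ω^{-(k+1)}` and `r = p √ω`, so that `t² - α t - β = (t - p) (t - r)`. Then
`z = v u - p u v` satisfies `v z = r z v` and `z u = r u z`, and the monomials `uⁱ zʲ vˡ` form a
basis of the down-up algebra `A(α, β)`. They span by these rules. They are independent, because the rules prescribe a
representation on the vector space with basis `ℕ × ℕ × ℕ`, in which `uⁱ zʲ vˡ` carries the first
basis vector to the one with index `(i, j, l)` (`DownUp.linearIndependent_monomials`).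

The element `x` of the Taft algebra kills `u` and `z`, and
`x · vˡ = q (cₗ u vˡ⁻¹ + dₗ z vˡ⁻²)` with explicit scalars `cₗ` and `dₗ` (`uCoeff`, `zCoeff`). Here
`cₗ` vanishes exactly when `n ∣ l`, and `dₗ` vanishes too in this case, because `√ω` has order `n`.
Hence `u`, `z` and `vⁿ` are invariant. Conversely, comparing coefficients in `x · a = 0`, by
induction on the exponent of `z`, shows that in an invariant `a` only monomials with `n ∣ l` occur
(`IsDownUpAction.coord_eq_zero`). So the invariants have the basis `uⁱ zʲ v^{n m}`, and they are the
skew polynomial ring in `u`, `z`, `vⁿ`, where `vⁿ` is central (`IsDownUpAction.isQuantumSpace`).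

It remains to see that a skew polynomial ring `A` in `x`, `y`, `w`, with `y x = λ x y`, with `w`
central and with generators of positive degrees, is Artin–Schelter regular of dimension three
(`IsQuantumSpace.isASRegular`). Everything comes from one coordinate computation
(`isKoszulRegular_of_coordinates`). On the polynomials with coefficients in a module `M`, the
operators "right multiplication by a variable minus its action on `M`" form a regular sequence,
because dividing out one operator after the other evaluates one variable after the other. A regular
sequence has an exact Koszul complex. Applied to `A ⊗ M`, this gives a free resolution of length
three of each module `M`, so that the global dimension is at most three. Applied to the trivial
module `M = 𝕜`, it gives the graded Koszul resolution. The dual of this resolution is, up to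
scalars, the Koszul complex of the opposite algebra, which is a skew polynomial ring of the same
kind (`IsQuantumSpace.op`). So `Ext^i(𝕜, A)` is zero for `i ≠ 3` and is the trivial right module,
with a shift, for `i = 3`, and the bounds on the dimensions are attained. The growth is polynomial,
because the `m`-th power of a space of polynomials with exponents at most `N` has exponents at most
`N m`.
-/

/-! ### Projective resolutions of length three -/

section Resolution

open CategoryTheory CategoryTheory.Abelian

variable {R : Type v} [Ring R]

theorem hasProjectiveDimensionLT_of_ker {P M : Type v} [AddCommGroup P] [Module R P]
    [AddCommGroup M] [Module R M] [Module.Projective R P] (f : P →ₗ[R] M)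
    (hf : Function.Surjective f) (n : ℕ)
    (h : HasProjectiveDimensionLT (ModuleCat.of R (LinearMap.ker f)) (n + 1)) :
    HasProjectiveDimensionLT (ModuleCat.of R M) (n + 2) := by
  have hS := LinearMap.shortExact_shortComplexKer hf
  have hP : Projective f.shortComplexKer.X₂ := (IsProjective.iff_projective (R := R) P).mp ‹_›
  exact (hS.hasProjectiveDimensionLT_X₃_iff n hP).mpr h

/-- Dimension shifting. -/
theorem subsingleton_ext_ker {P M : Type v} [AddCommGroup P] [Module R P]
    [AddCommGroup M] [Module R M] [Module.Projective R P] (f : P →ₗ[R] M)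
    (hf : Function.Surjective f) (Y : ModuleCat.{v} R) (n : ℕ)
    (h : Subsingleton (Ext (ModuleCat.of R M) Y (n + 2))) :
    Subsingleton (Ext (ModuleCat.of R (LinearMap.ker f)) Y (n + 1)) := by
  have hS := LinearMap.shortExact_shortComplexKer hf
  have hP : Projective f.shortComplexKer.X₂ := (IsProjective.iff_projective (R := R) P).mp ‹_›
  refine subsingleton_of_forall_eq 0 fun y => ?_
  obtain ⟨y', hy'⟩ := Ext.contravariant_sequence_exact₁ hS Y y (add_comm 1 (n + 1))
    (Subsingleton.elim (α := Ext (ModuleCat.of R M) Y (n + 2)) _ _)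
  rw [← hy', Ext.eq_zero_of_projective y', Ext.comp_zero]

theorem exists_extension_of_subsingleton_ext_one {P M : Type v} [AddCommGroup P] [Module R P]
    [AddCommGroup M] [Module R M] (f : P →ₗ[R] M)
    (hf : Function.Surjective f) (Y : Type v) [AddCommGroup Y] [Module R Y]
    (h : Subsingleton (Ext (ModuleCat.of R M) (ModuleCat.of R Y) 1))
    (g : LinearMap.ker f →ₗ[R] Y) : ∃ g' : P →ₗ[R] Y, ∀ p : LinearMap.ker f, g' p = g p := by
  have hS := LinearMap.shortExact_shortComplexKer hf
  obtain ⟨y, hy⟩ := Ext.contravariant_sequence_exact₁ hS (ModuleCat.of R Y)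
    (Ext.mk₀ (ModuleCat.ofHom g)) (add_comm 1 0)
    (Subsingleton.elim (α := Ext (ModuleCat.of R M) (ModuleCat.of R Y) 1) _ _)
  obtain ⟨y, rfl⟩ := Ext.mk₀_bijective _ _ |>.2 y
  rw [Ext.mk₀_comp_mk₀] at hy
  have hy := (Ext.mk₀_bijective _ _).1 hy
  exact ⟨y.hom, fun p => congrArg (fun t => t.hom p) hy⟩

variable {P₃ P₂ P₁ P₀ M : Type v} [AddCommGroup P₃] [AddCommGroup P₂] [AddCommGroup P₁]
  [AddCommGroup P₀] [AddCommGroup M] [Module R P₃] [Module R P₂] [Module R P₁] [Module R P₀]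
  [Module R M] {d₃ : P₃ →ₗ[R] P₂} {d₂ : P₂ →ₗ[R] P₁} {d₁ : P₁ →ₗ[R] P₀} {ε : P₀ →ₗ[R] M}

/-- The map onto the kernel of the next map of an exact sequence. -/
def toKer {P Q N : Type v} [AddCommGroup P] [AddCommGroup Q] [AddCommGroup N] [Module R P]
    [Module R Q] [Module R N] {f : P →ₗ[R] Q} {g : Q →ₗ[R] N} (h : Function.Exact f g) :
    P →ₗ[R] LinearMap.ker g :=
  f.codRestrict _ fun p => h.apply_apply_eq_zero p

theorem toKer_surjective {P Q N : Type v} [AddCommGroup P] [AddCommGroup Q] [AddCommGroup N]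
    [Module R P] [Module R Q] [Module R N] {f : P →ₗ[R] Q} {g : Q →ₗ[R] N}
    (h : Function.Exact f g) : Function.Surjective (toKer h) := by
  rintro ⟨q, hq⟩
  obtain ⟨p, rfl⟩ := (h q).mp hq
  exact ⟨p, rfl⟩

theorem ker_toKer {P Q N : Type v} [AddCommGroup P] [AddCommGroup Q] [AddCommGroup N]
    [Module R P] [Module R Q] [Module R N] {f : P →ₗ[R] Q} {g : Q →ₗ[R] N}
    (h : Function.Exact f g) : LinearMap.ker (toKer h) = LinearMap.ker f :=
  LinearMap.ker_codRestrict _ _ _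

/-- The first map of an exact sequence that starts with an injection, as an isomorphism onto the
kernel that it maps to. -/
noncomputable def equivKer {P Q N : Type v} [AddCommGroup P] [AddCommGroup Q] [AddCommGroup N]
    [Module R P] [Module R Q] [Module R N] {f : P →ₗ[R] Q} {g : Q →ₗ[R] N}
    (h : Function.Exact f g) (hf : Function.Injective f) : P ≃ₗ[R] LinearMap.ker g :=
  LinearEquiv.ofBijective (toKer h)
    ⟨fun _ _ hab => hf (congrArg Subtype.val hab), toKer_surjective h⟩

/-- A module with a projective resolution of length three has projective dimension at most three. -/
theorem hasProjectiveDimensionLT_four [Module.Projective R P₃] [Module.Projective R P₂]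
    [Module.Projective R P₁] [Module.Projective R P₀] (h₃ : Function.Injective d₃)
    (h₃₂ : Function.Exact d₃ d₂) (h₂₁ : Function.Exact d₂ d₁) (h₁₀ : Function.Exact d₁ ε)
    (hε : Function.Surjective ε) : HasProjectiveDimensionLT (ModuleCat.of R M) 4 := by
  refine hasProjectiveDimensionLT_of_ker ε hε 2 ?_
  refine hasProjectiveDimensionLT_of_ker (toKer h₁₀) (toKer_surjective h₁₀) 1 ?_
  rw [ker_toKer]
  refine hasProjectiveDimensionLT_of_ker (toKer h₂₁) (toKer_surjective h₂₁) 0 ?_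
  rw [ker_toKer]
  have := Module.Projective.of_equiv (equivKer h₃₂ h₃)
  have : Projective (ModuleCat.of R (LinearMap.ker d₂)) :=
    (IsProjective.iff_projective (R := R) _).mp this
  infer_instance

/-- If `Ext³(M, Y) = 0`, then maps from the last term of a projective resolution of length three
of `M` to `Y` extend along the last differential. -/
theorem exists_extension_of_subsingleton_ext_three [Module.Projective R P₁]
    [Module.Projective R P₀] (h₃ : Function.Injective d₃)
    (h₃₂ : Function.Exact d₃ d₂) (h₂₁ : Function.Exact d₂ d₁) (h₁₀ : Function.Exact d₁ ε)
    (hε : Function.Surjective ε) {Y : Type v} [AddCommGroup Y] [Module R Y]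
    (h : Subsingleton (Ext (ModuleCat.of R M) (ModuleCat.of R Y) 3)) (g : P₃ →ₗ[R] Y) :
    ∃ g' : P₂ →ₗ[R] Y, g' ∘ₗ d₃ = g := by
  have h2 := subsingleton_ext_ker ε hε _ 1 h
  have h1 := subsingleton_ext_ker (toKer h₁₀) (toKer_surjective h₁₀) _ 0 h2
  rw [ker_toKer] at h1
  have h0 := exists_extension_of_subsingleton_ext_one (toKer h₂₁) (toKer_surjective h₂₁) Y h1
  rw [ker_toKer] at h0
  obtain ⟨g', hg'⟩ := h0 (g ∘ₗ (equivKer h₃₂ h₃).symm.toLinearMap)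
  refine ⟨g', LinearMap.ext fun p => ?_⟩
  have := hg' (equivKer h₃₂ h₃ p)
  rw [LinearMap.comp_apply, LinearEquiv.coe_coe, LinearEquiv.symm_apply_apply] at this
  exact this

end Resolution

/-! ### Koszul complexes of three twisted commuting operators -/

section Koszul

variable {R : Type v} [Ring R] {P : Type w} [AddCommGroup P] [Module R P]

/-- Five operators on a module that give rise to an exact Koszul complex: `X`, `Y`, `W` form a
regular sequence, where the commutation of `X` and `Y` is twisted, `X Y' = Y X'`, and everything
commutes with `W`. -/
structure IsKoszulRegular (X Y W X' Y' : P →ₗ[R] P) : Prop where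
  comm : ∀ p, X (Y' p) = Y (X' p)
  comm_X : ∀ p, X (W p) = W (X p)
  comm_Y : ∀ p, Y (W p) = W (Y p)
  comm_X' : ∀ p, X' (W p) = W (X' p)
  comm_Y' : ∀ p, Y' (W p) = W (Y' p)
  eq_zero : ∀ p, X p = 0 → p = 0
  eq_zero' : ∀ p, X' p = 0 → p = 0
  regular_Y : ∀ p a, Y p = X a → ∃ h, p = X' h
  regular_W : ∀ p a b, W p = X a + Y b → ∃ a' b', p = X a' + Y b'

/-- The first differential `(a, b, c) ↦ X a + Y b + W c` of the Koszul complex. -/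
def koszulOne (X Y W : P →ₗ[R] P) : (Fin 3 → P) →ₗ[R] P :=
  X ∘ₗ LinearMap.proj 0 + Y ∘ₗ LinearMap.proj 1 + W ∘ₗ LinearMap.proj 2

/-- The second differential `(a, b, c) ↦ (-Y' a - W b, X' a - W c, X b + Y c)` of the Koszul
complex. -/
def koszulTwo (X Y W X' Y' : P →ₗ[R] P) : (Fin 3 → P) →ₗ[R] (Fin 3 → P) :=
  LinearMap.pi ![-(Y' ∘ₗ LinearMap.proj 0) - W ∘ₗ LinearMap.proj 1,
    X' ∘ₗ LinearMap.proj 0 - W ∘ₗ LinearMap.proj 2,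
    X ∘ₗ LinearMap.proj 1 + Y ∘ₗ LinearMap.proj 2]

/-- The last differential `h ↦ (W h, -Y' h, X' h)` of the Koszul complex. -/
def koszulThree (W X' Y' : P →ₗ[R] P) : P →ₗ[R] (Fin 3 → P) :=
  LinearMap.pi ![W, -Y', X']

variable {X Y W X' Y' : P →ₗ[R] P}

theorem koszulOne_apply (f : Fin 3 → P) : koszulOne X Y W f = X (f 0) + Y (f 1) + W (f 2) := rfl

theorem koszulTwo_apply (f : Fin 3 → P) : koszulTwo X Y W X' Y' f =
    ![-Y' (f 0) - W (f 1), X' (f 0) - W (f 2), X (f 1) + Y (f 2)] := by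
  ext i; fin_cases i <;> simp [koszulTwo]

theorem koszulThree_apply (h : P) : koszulThree W X' Y' h = ![W h, -Y' h, X' h] := by
  ext i; fin_cases i <;> simp [koszulThree]

namespace IsKoszulRegular

theorem koszulThree_injective (H : IsKoszulRegular X Y W X' Y') :
    Function.Injective (koszulThree W X' Y') := by
  rw [injective_iff_map_eq_zero]
  intro h hh
  rw [koszulThree_apply] at hh
  exact H.eq_zero' h (congrFun hh 2)

theorem exact_three_two (H : IsKoszulRegular X Y W X' Y') :
    Function.Exact (koszulThree W X' Y') (koszulTwo X Y W X' Y') := by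
  intro f
  constructor
  · intro hf
    rw [koszulTwo_apply] at hf
    have h1 : X' (f 0) - W (f 2) = 0 := congrFun hf 1
    have h2 : X (f 1) + Y (f 2) = 0 := congrFun hf 2
    obtain ⟨h, hh⟩ := H.regular_Y (f 2) (-f 1) (by
      rw [map_neg]; exact eq_neg_of_add_eq_zero_right h2)
    refine ⟨h, ?_⟩
    have e1 : f 1 = -Y' h := by
      rw [← sub_eq_zero]
      apply H.eq_zero
      rw [sub_neg_eq_add, map_add, H.comm, ← hh, h2]
    have e0 : f 0 = W h := by
      rw [← sub_eq_zero]
      apply H.eq_zero'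
      rw [map_sub, H.comm_X', ← hh, h1]
    rw [koszulThree_apply]
    ext i
    fin_cases i
    · exact e0.symm
    · exact e1.symm
    · exact hh.symm
  · rintro ⟨h, rfl⟩
    rw [koszulThree_apply, koszulTwo_apply]
    ext i
    fin_cases i <;> simp [H.comm, H.comm_X', H.comm_Y']

theorem exact_two_one (H : IsKoszulRegular X Y W X' Y') :
    Function.Exact (koszulTwo X Y W X' Y') (koszulOne X Y W) := by
  intro f
  constructor
  · intro hf
    rw [koszulOne_apply] at hf
    obtain ⟨a, b, hc⟩ := H.regular_W (f 2) (-f 0) (-f 1) (by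
      rw [map_neg, map_neg, ← neg_add]; exact eq_neg_of_add_eq_zero_right hf)
    have h1 : X (f 0 + W a) + Y (f 1 + W b) = 0 := by
      rw [map_add, map_add, H.comm_X, H.comm_Y, ← hf, hc, map_add]
      abel
    obtain ⟨e, he⟩ := H.regular_Y (f 1 + W b) (-(f 0 + W a)) (by
      rw [map_neg]; exact eq_neg_of_add_eq_zero_right h1)
    have h2 : f 0 + W a + Y' e = 0 := by
      apply H.eq_zero
      rw [map_add, H.comm, ← he, h1]
    refine ⟨![e, a, b], ?_⟩
    rw [koszulTwo_apply]
    ext i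
    fin_cases i
    · change -Y' e - W a = f 0
      rw [← sub_eq_zero, ← neg_eq_zero, ← h2]
      abel
    · change X' e - W b = f 1
      rw [← he]
      abel
    · exact hc.symm
  · rintro ⟨f, rfl⟩
    rw [koszulTwo_apply, koszulOne_apply]
    simp only [Matrix.cons_val]
    rw [map_sub, map_sub, map_neg, map_add, H.comm, H.comm_X, H.comm_Y]
    abel

end IsKoszulRegular

end Koszul

/-! ### Evaluation of polynomials at an endomorphism -/

section Evaluation

variable {𝕜 : Type u} [CommRing 𝕜] {N : Type w} [AddCommGroup N] [Module 𝕜 N]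

/-- The operator `t - θ` on the polynomials in `t` with coefficients in `N`. -/
noncomputable def shiftSub (θ : N →ₗ[𝕜] N) : (ℕ →₀ N) →ₗ[𝕜] (ℕ →₀ N) :=
  Finsupp.lmapDomain N 𝕜 Nat.succ - Finsupp.mapRange.linearMap θ

/-- The evaluation `∑ tʲ nⱼ ↦ ∑ θʲ nⱼ`. -/
noncomputable def evalAt (θ : N →ₗ[𝕜] N) : (ℕ →₀ N) →ₗ[𝕜] N :=
  Finsupp.lsum 𝕜 fun j => θ ^ j

theorem shiftSub_single (θ : N →ₗ[𝕜] N) (j : ℕ) (m : N) :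
    shiftSub θ (Finsupp.single j m) = Finsupp.single (j + 1) m - Finsupp.single j (θ m) := by
  simp [shiftSub, Finsupp.mapDomain_single]

theorem evalAt_single (θ : N →ₗ[𝕜] N) (j : ℕ) (m : N) :
    evalAt θ (Finsupp.single j m) = (θ ^ j) m := by
  simp [evalAt]

theorem evalAt_surjective (θ : N →ₗ[𝕜] N) : Function.Surjective (evalAt θ) := fun m =>
  ⟨Finsupp.single 0 m, by simp [evalAt_single]⟩

theorem evalAt_shiftSub (θ : N →ₗ[𝕜] N) (p : ℕ →₀ N) : evalAt θ (shiftSub θ p) = 0 := by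
  have : evalAt θ ∘ₗ shiftSub θ = 0 := by
    ext j m
    simp [shiftSub_single, evalAt_single, pow_succ]
  exact congrArg (fun f => f p) this

theorem exists_eq_shiftSub_add (θ : N →ₗ[𝕜] N) (p : ℕ →₀ N) :
    ∃ p', p = shiftSub θ p' + Finsupp.single 0 (evalAt θ p) := by
  induction p using Finsupp.induction_linear with
  | zero => exact ⟨0, by simp⟩
  | add f g hf hg =>
    obtain ⟨f', hf⟩ := hf
    obtain ⟨g', hg⟩ := hg
    refine ⟨f' + g', ?_⟩
    rw [map_add, map_add, Finsupp.single_add]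
    nth_rewrite 1 [hf, hg]
    abel
  | single j m =>
    rw [evalAt_single]
    induction j generalizing m with
    | zero => exact ⟨0, by simp⟩
    | succ j ih =>
      obtain ⟨p', hp'⟩ := ih (θ m)
      refine ⟨Finsupp.single j m + p', ?_⟩
      rw [map_add, shiftSub_single, pow_succ, Module.End.mul_apply, add_assoc, ← hp',
        sub_add_cancel]

theorem exists_eq_shiftSub (θ : N →ₗ[𝕜] N) (p : ℕ →₀ N) (h : evalAt θ p = 0) :
    ∃ p', p = shiftSub θ p' := by
  obtain ⟨p', hp'⟩ := exists_eq_shiftSub_add θ p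
  exact ⟨p', by simpa [h] using hp'⟩

theorem eq_zero_of_shiftSub_eq_zero (θ : N →ₗ[𝕜] N) (p : ℕ →₀ N) (h : shiftSub θ p = 0) :
    p = 0 := by
  have step : ∀ j, p j = θ (p (j + 1)) := by
    intro j
    have := DFunLike.congr_fun h (j + 1)
    simp only [shiftSub, LinearMap.sub_apply, Finsupp.lmapDomain_apply, Finsupp.coe_sub,
      Pi.sub_apply, Finsupp.mapRange.linearMap_apply, Finsupp.mapRange_apply,
      Finsupp.mapDomain_apply Nat.succ_injective, Finsupp.coe_zero, Pi.zero_apply] at this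
    exact sub_eq_zero.mp this
  obtain ⟨b, hb⟩ := p.support.bddAbove
  have large : ∀ i j, b < i + j → p j = 0 := by
    intro i
    induction i with
    | zero =>
      intro j hj
      by_contra hne
      have := hb (Finsupp.mem_support_iff.mpr hne)
      omega
    | succ i ih =>
      intro j hj
      rw [step j, ih (j + 1) (by omega), map_zero]
  ext j
  exact large (b + 1) j (by omega)

end Evaluation

/-! ### Koszul regularity in coordinates -/

section Regular

variable {𝕜 : Type u} [CommRing 𝕜] {R : Type v} [Ring R] [Algebra 𝕜 R] {P : Type w}
  [AddCommGroup P] [Module 𝕜 P] [Module R P] [IsScalarTower 𝕜 R P] {M : Type*}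
  [AddCommGroup M] [Module 𝕜 M]

theorem qcomm_pow_apply {lam : 𝕜} {x y : M →ₗ[𝕜] M} (h : ∀ m, y (x m) = lam • x (y m)) (j : ℕ)
    (m : M) : (y ^ j) (x m) = lam ^ j • x ((y ^ j) m) := by
  induction j generalizing m with
  | zero => simp
  | succ j ih => rw [pow_succ, Module.End.mul_apply, h, map_smul, ih, smul_smul, pow_succ',
      Module.End.mul_apply]

theorem mapRange_pow (θ : M →ₗ[𝕜] M) (j i : ℕ) (m : M) :
    ((Finsupp.mapRange.linearMap θ : (ℕ →₀ M) →ₗ[𝕜] (ℕ →₀ M)) ^ j) (Finsupp.single i m) =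
      Finsupp.single i ((θ ^ j) m) := by
  induction j generalizing m with
  | zero => simp
  | succ j ih => rw [pow_succ, Module.End.mul_apply, Finsupp.mapRange.linearMap_apply,
      Finsupp.mapRange_single, ih, pow_succ, Module.End.mul_apply]

/-- Let `P` be the polynomials in `y`, `x`, `w` with coefficients in `M`, the coefficient of
`xⁱ yʲ wˡ` being placed at `(j, i, l)`. If `M` has endomorphisms `x`, `y`, `w` with
`y x = λ x y` and commuting otherwise, then the operators "right multiplication minus action on
`M`" are regular, and what they generate is the kernel of the evaluation: dividing out one
operator after the other amounts to evaluating one variable after the other. -/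
theorem isKoszulRegular_of_coordinates {lam : 𝕜} {x y w : M →ₗ[𝕜] M}
    (hyx : ∀ m, y (x m) = lam • x (y m)) (hwx : ∀ m, w (x m) = x (w m))
    (hwy : ∀ m, w (y m) = y (w m)) (Φ : P ≃ₗ[𝕜] (ℕ →₀ ℕ →₀ ℕ →₀ M))
    (μ : ℕ → ℕ → ℕ → M → P)
    (hμ : ∀ j i l m, μ j i l m = Φ.symm (Finsupp.single j (Finsupp.single i (Finsupp.single l m))))
    {X Y W X' Y' : P →ₗ[R] P}
    (hX : ∀ j i l m, X (μ j i l m) = μ (j + 1) i l m - μ j i l (y m))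
    (hX' : ∀ j i l m, X' (μ j i l m) = μ (j + 1) i l m - μ j i l (lam • y m))
    (hY : ∀ j i l m, Y (μ j i l m) = lam ^ j • μ j (i + 1) l m - μ j i l (x m))
    (hW : ∀ j i l m, W (μ j i l m) = μ j i (l + 1) m - μ j i l (w m))
    (comm : ∀ p, X (Y' p) = Y (X' p)) (comm_X : ∀ p, X (W p) = W (X p))
    (comm_Y : ∀ p, Y (W p) = W (Y p)) (comm_X' : ∀ p, X' (W p) = W (X' p))
    (comm_Y' : ∀ p, Y' (W p) = W (Y' p)) (ε : P →ₗ[𝕜] M)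
    (hε : ∀ j i l m, ε (μ j i l m) = (w ^ l) ((x ^ i) ((y ^ j) m))) :
    IsKoszulRegular X Y W X' Y' ∧
      ∀ p, ε p = 0 → ∃ a b c, p = X a + Y b + W c := by
  let x₁ : (ℕ →₀ M) →ₗ[𝕜] (ℕ →₀ M) := Finsupp.mapRange.linearMap x
  let y₁ : (ℕ →₀ M) →ₗ[𝕜] (ℕ →₀ M) := Finsupp.mapRange.linearMap y
  let y₂ : (ℕ →₀ ℕ →₀ M) →ₗ[𝕜] (ℕ →₀ ℕ →₀ M) := Finsupp.mapRange.linearMap y₁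
  have hx₁ : ∀ l m, x₁ (Finsupp.single l m) = Finsupp.single l (x m) := fun l m => by simp [x₁]
  have hy₂ : ∀ i l m, y₂ (Finsupp.single i (Finsupp.single l m)) =
    Finsupp.single i (Finsupp.single l (y m)) := fun i l m => by simp [y₁, y₂]
  have hy₂p : ∀ j i l m, (y₂ ^ j) (Finsupp.single i (Finsupp.single l m)) =
      Finsupp.single i (Finsupp.single l ((y ^ j) m)) := fun j i l m => by
    rw [mapRange_pow, mapRange_pow]
  have hx₁p : ∀ i l m, (x₁ ^ i) (Finsupp.single l m) = Finsupp.single l ((x ^ i) m) :=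
    fun i l m => mapRange_pow _ _ _ _
  have ext : ∀ {Q : Type _} [AddCommGroup Q] [Module 𝕜 Q] (f g : P →ₗ[𝕜] Q),
      (∀ j i l m, f (μ j i l m) = g (μ j i l m)) → ∀ p, f p = g p := by
    intro Q _ _ f g h p
    have : f ∘ₗ Φ.symm.toLinearMap = g ∘ₗ Φ.symm.toLinearMap := by
      ext j i l m
      simpa [hμ] using h j i l m
    simpa using congrArg (fun t => t (Φ p)) this
  have hΦμ : ∀ j i l m, Φ (μ j i l m) =
      Finsupp.single j (Finsupp.single i (Finsupp.single l m)) := fun j i l m => by simp [hμ]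
  -- The evaluations of `y`, plain and twisted, and then of `x`.
  let e₁ : P →ₗ[𝕜] (ℕ →₀ ℕ →₀ M) := evalAt y₂ ∘ₗ Φ.toLinearMap
  let e₁' : P →ₗ[𝕜] (ℕ →₀ ℕ →₀ M) := evalAt (lam • y₂) ∘ₗ Φ.toLinearMap
  have he₁ : ∀ j i l m, e₁ (μ j i l m) = Finsupp.single i (Finsupp.single l ((y ^ j) m)) := by
    intro j i l m
    rw [LinearMap.comp_apply, LinearEquiv.coe_coe, hΦμ, evalAt_single, hy₂p]
  have he₁' : ∀ j i l m, e₁' (μ j i l m) =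
      lam ^ j • Finsupp.single i (Finsupp.single l ((y ^ j) m)) := by
    intro j i l m
    rw [LinearMap.comp_apply, LinearEquiv.coe_coe, hΦμ, evalAt_single, smul_pow,
      LinearMap.smul_apply, hy₂p]
  have ΦX : ∀ p, Φ (X p) = shiftSub y₂ (Φ p) :=
    ext (Φ.toLinearMap ∘ₗ X.restrictScalars 𝕜) (shiftSub y₂ ∘ₗ Φ.toLinearMap) fun j i l m => by
      simp [hX, hΦμ, shiftSub_single, hy₂]
  have ΦX' : ∀ p, Φ (X' p) = shiftSub (lam • y₂) (Φ p) :=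
    ext (Φ.toLinearMap ∘ₗ X'.restrictScalars 𝕜) (shiftSub (lam • y₂) ∘ₗ Φ.toLinearMap)
      fun j i l m => by
        simp [hX', hΦμ, shiftSub_single, hy₂]
  have e₁Y : ∀ p, e₁ (Y p) = shiftSub x₁ (e₁' p) :=
    ext (e₁ ∘ₗ Y.restrictScalars 𝕜) (shiftSub x₁ ∘ₗ e₁') fun j i l m => by
      simp only [LinearMap.comp_apply, LinearMap.restrictScalars_apply, hY, map_sub, map_smul,
        he₁, he₁', shiftSub_single, hx₁, qcomm_pow_apply hyx]
      simp [smul_sub]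
  let w₂ : (ℕ →₀ ℕ →₀ M) →ₗ[𝕜] (ℕ →₀ ℕ →₀ M) := Finsupp.mapRange.linearMap (shiftSub w)
  have hyw : ∀ j m, (y ^ j) (w m) = w ((y ^ j) m) := fun j m => by
    simpa using qcomm_pow_apply (lam := (1 : 𝕜)) (x := w) (y := y) (by simp [hwy]) j m
  have hxw : ∀ j m, (x ^ j) (w m) = w ((x ^ j) m) := fun j m => by
    simpa using qcomm_pow_apply (lam := (1 : 𝕜)) (x := w) (y := x) (by simp [hwx]) j m
  let e₂ : P →ₗ[𝕜] (ℕ →₀ M) := evalAt x₁ ∘ₗ e₁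
  have he₂ : ∀ j i l m, e₂ (μ j i l m) = Finsupp.single l ((x ^ i) ((y ^ j) m)) := by
    intro j i l m
    rw [LinearMap.comp_apply, he₁, evalAt_single, hx₁p]
  have e₂W : ∀ p, e₂ (W p) = shiftSub w (e₂ p) :=
    ext (e₂ ∘ₗ W.restrictScalars 𝕜) (shiftSub w ∘ₗ e₂) fun j i l m => by
      simp [hW, he₂, shiftSub_single, hyw, hxw]
  have e₃ : ∀ p, ε p = evalAt w (e₂ p) := ext ε (evalAt w ∘ₗ e₂) fun j i l m => by
    simp [hε, he₂, evalAt_single]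
  have e₁X : ∀ p, e₁ (X p) = 0 := fun p => by
    change evalAt y₂ (Φ (X p)) = 0
    rw [ΦX, evalAt_shiftSub]
  have e₁_surj : Function.Surjective e₁ := (evalAt_surjective _).comp Φ.surjective
  have e₁'_surj : Function.Surjective e₁' := (evalAt_surjective _).comp Φ.surjective
  have e₂_surj : Function.Surjective e₂ := (evalAt_surjective _).comp e₁_surj
  have e₂X : ∀ p, e₂ (X p) = 0 := fun p => by
    change evalAt x₁ (e₁ (X p)) = 0
    rw [e₁X, map_zero]
  have e₂Y : ∀ p, e₂ (Y p) = 0 := fun p => by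
    change evalAt x₁ (e₁ (Y p)) = 0
    rw [e₁Y, evalAt_shiftSub]
  have ker_e₁ : ∀ p, e₁ p = 0 → ∃ a, p = X a := by
    intro p hp
    obtain ⟨t, ht⟩ := exists_eq_shiftSub y₂ (Φ p) hp
    exact ⟨Φ.symm t, Φ.injective (by rw [ΦX, ht, Φ.apply_symm_apply])⟩
  have ker_e₁' : ∀ p, e₁' p = 0 → ∃ a, p = X' a := by
    intro p hp
    obtain ⟨t, ht⟩ := exists_eq_shiftSub (lam • y₂) (Φ p) hp
    exact ⟨Φ.symm t, Φ.injective (by rw [ΦX', ht, Φ.apply_symm_apply])⟩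
  have ker_e₂ : ∀ p, e₂ p = 0 → ∃ a b, p = X a + Y b := by
    intro p hp
    obtain ⟨t, ht⟩ := exists_eq_shiftSub x₁ (e₁ p) hp
    obtain ⟨b, rfl⟩ := e₁'_surj t
    obtain ⟨a, ha⟩ := ker_e₁ (p - Y b) (by rw [map_sub, ht, e₁Y, sub_self])
    exact ⟨a, b, by rw [← ha]; abel⟩
  refine ⟨⟨comm, comm_X, comm_Y, comm_X', comm_Y', ?_, ?_, ?_, ?_⟩, ?_⟩
  · intro p hp
    exact Φ.map_eq_zero_iff.mp (eq_zero_of_shiftSub_eq_zero _ _ (by rw [← ΦX, hp, map_zero]))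
  · intro p hp
    exact Φ.map_eq_zero_iff.mp (eq_zero_of_shiftSub_eq_zero _ _ (by rw [← ΦX', hp, map_zero]))
  · intro p a hpa
    refine ker_e₁' p (eq_zero_of_shiftSub_eq_zero x₁ _ ?_)
    rw [← e₁Y, hpa, e₁X]
  · intro p a b hp
    refine ker_e₂ p (eq_zero_of_shiftSub_eq_zero w _ ?_)
    rw [← e₂W, hp, map_add, e₂X, e₂Y, add_zero]
  · intro p hp
    obtain ⟨t, ht⟩ := exists_eq_shiftSub w (e₂ p) (by rw [← e₃, hp])
    obtain ⟨c, rfl⟩ := e₂_surj t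
    obtain ⟨a, b, hab⟩ := ker_e₂ (p - W c) (by rw [map_sub, ht, e₂W, sub_self])
    exact ⟨a, b, c, by rw [← hab]; abel⟩

end Regular

/-! ### Quantum affine three-spaces -/

section QuantumSpace

variable {𝕜 : Type u} {A : Type v} [Field 𝕜] [Ring A] [Algebra 𝕜 A]

/-- The monomial `xⁱ yʲ wˡ`, for `t = (i, j, l)`. -/
def monomial₃ (x y w : A) (t : ℕ × ℕ × ℕ) : A := x ^ t.1 * y ^ t.2.1 * w ^ t.2.2

/-- The graded algebra `A` is the skew polynomial ring in `x`, `y` and `w`, of positive degrees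
`a`, `b` and `c`, where `y x = λ x y` and `w` is central. Being a skew polynomial ring is expressed
by the ordered monomials being a basis. -/
structure IsQuantumSpace (𝒜 : ℕ → Submodule 𝕜 A) (lam : 𝕜) (x y w : A) (a b c : ℕ) : Prop where
  lam_ne_zero : lam ≠ 0
  y_mul_x : y * x = lam • (x * y)
  w_mul_x : w * x = x * w
  w_mul_y : w * y = y * w
  a_pos : 0 < a
  b_pos : 0 < b
  c_pos : 0 < c
  linearIndependent : LinearIndependent 𝕜 (monomial₃ x y w)
  span_eq_top : ⊤ ≤ Submodule.span 𝕜 (Set.range (monomial₃ x y w))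
  piece_eq : ∀ d, 𝒜 d =
    Submodule.span 𝕜 (monomial₃ x y w '' {t | a * t.1 + b * t.2.1 + c * t.2.2 = d})

/-- Coordinates `(i, j, l)` rewritten as iterated polynomials, with the index `j` outermost. -/
noncomputable def curry₃ (𝕜 : Type u) [Field 𝕜] (M : Type w) [AddCommGroup M] [Module 𝕜 M] :
    (ℕ × ℕ × ℕ →₀ M) ≃ₗ[𝕜] (ℕ →₀ ℕ →₀ ℕ →₀ M) :=
  (Finsupp.domLCongr (⟨fun t => (t.2.1, t.1, t.2.2), fun t => (t.2.1, t.1, t.2.2),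
    fun _ => rfl, fun _ => rfl⟩ : ℕ × ℕ × ℕ ≃ ℕ × ℕ × ℕ)).trans
  ((Finsupp.curryLinearEquiv 𝕜).trans
    (Finsupp.mapRange.linearEquiv (Finsupp.curryLinearEquiv 𝕜)))

theorem curry₃_single {M : Type w} [AddCommGroup M] [Module 𝕜 M] (j i l : ℕ) (m : M) :
    curry₃ 𝕜 M (Finsupp.single (i, j, l) m) =
      Finsupp.single j (Finsupp.single i (Finsupp.single l m)) := by
  simp [curry₃, Finsupp.curryLinearEquiv]

theorem curry₃_symm_single {M : Type w} [AddCommGroup M] [Module 𝕜 M] (j i l : ℕ) (m : M) :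
    (curry₃ 𝕜 M).symm (Finsupp.single j (Finsupp.single i (Finsupp.single l m))) =
      Finsupp.single (i, j, l) m := by
  rw [LinearEquiv.symm_apply_eq, curry₃_single]

/-- Right multiplication by `r`, as a map of left modules. -/
def rmul (r : A) : A →ₗ[A] A := LinearMap.toSpanSingleton A A r

theorem rmul_apply (r b : A) : rmul r b = b * r := rfl

namespace IsQuantumSpace

variable {𝒜 : ℕ → Submodule 𝕜 A} {lam : 𝕜} {x y w : A} {a b c : ℕ}

theorem y_pow_mul_x (H : IsQuantumSpace 𝒜 lam x y w a b c) (j : ℕ) :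
    y ^ j * x = lam ^ j • (x * y ^ j) := by
  induction j with
  | zero => simp
  | succ j ih =>
    rw [pow_succ', mul_assoc, ih, mul_smul_comm, ← mul_assoc, H.y_mul_x, smul_mul_assoc,
      smul_smul, mul_assoc, ← pow_succ]

theorem y_pow_mul_x_pow (H : IsQuantumSpace 𝒜 lam x y w a b c) (j i : ℕ) :
    y ^ j * x ^ i = lam ^ (j * i) • (x ^ i * y ^ j) := by
  induction i with
  | zero => simp
  | succ i ih =>
    rw [pow_succ, ← mul_assoc, ih, smul_mul_assoc, mul_assoc, H.y_pow_mul_x, mul_smul_comm,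
      smul_smul, ← pow_add, mul_assoc]
    rfl

/-- The ordered monomials as a basis. -/
noncomputable def basis (H : IsQuantumSpace 𝒜 lam x y w a b c) :
    Module.Basis (ℕ × ℕ × ℕ) 𝕜 A := Module.Basis.mk H.linearIndependent H.span_eq_top

theorem basis_apply (H : IsQuantumSpace 𝒜 lam x y w a b c) (t : ℕ × ℕ × ℕ) :
    H.basis t = monomial₃ x y w t := by simp [basis]

theorem monomial_mul_y (H : IsQuantumSpace 𝒜 lam x y w a b c) (i j l : ℕ) :
    monomial₃ x y w (i, j, l) * y = monomial₃ x y w (i, j + 1, l) := by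
  have : Commute (w ^ l) y := Commute.pow_left H.w_mul_y l
  simp only [monomial₃, mul_assoc, this.eq, pow_succ]

theorem monomial_mul_w (i j l : ℕ) :
    monomial₃ x y w (i, j, l) * w = monomial₃ x y w (i, j, l + 1) := by
  simp only [monomial₃, mul_assoc, pow_succ]

theorem monomial_mul_x (H : IsQuantumSpace 𝒜 lam x y w a b c) (i j l : ℕ) :
    monomial₃ x y w (i, j, l) * x = lam ^ j • monomial₃ x y w (i + 1, j, l) := by
  have : Commute (w ^ l) x := Commute.pow_left H.w_mul_x l
  simp only [monomial₃, mul_assoc, this.eq, pow_succ]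
  rw [← mul_assoc (y ^ j), H.y_pow_mul_x]
  simp only [smul_mul_assoc, mul_smul_comm, mul_assoc]

/-- The augmentation, which takes the constant coefficient. -/
noncomputable def augmentation (H : IsQuantumSpace 𝒜 lam x y w a b c) : A →ₗ[𝕜] 𝕜 :=
  H.basis.coord (0, 0, 0)

theorem augmentation_monomial (H : IsQuantumSpace 𝒜 lam x y w a b c) (t : ℕ × ℕ × ℕ) :
    H.augmentation (monomial₃ x y w t) = if t = (0, 0, 0) then 1 else 0 := by
  rw [← H.basis_apply, augmentation, Module.Basis.coord_apply, Module.Basis.repr_self,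
    Finsupp.single_apply]

theorem augmentation_one (H : IsQuantumSpace 𝒜 lam x y w a b c) : H.augmentation 1 = 1 := by
  simpa [monomial₃] using H.augmentation_monomial (0, 0, 0)

/-- Right multiplication by the generators is regular on `A`, and the left ideal that they generate
is the kernel of the augmentation. This is the coordinate criterion for the trivial module `𝕜`. -/
theorem isKoszulRegular_rmul_aux (H : IsQuantumSpace 𝒜 lam x y w a b c) :
    IsKoszulRegular (rmul y) (rmul x) (rmul w) (rmul y) (lam • rmul x) ∧
      ∀ p, H.augmentation p = 0 → ∃ a b c, p = rmul y a + rmul x b + rmul w c := by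
  refine isKoszulRegular_of_coordinates (M := 𝕜) (lam := lam) (x := 0) (y := 0) (w := 0)
    (by simp) (by simp) (by simp) (H.basis.repr.trans (curry₃ 𝕜 𝕜))
    (fun j i l m => m • monomial₃ x y w (i, j, l)) ?_ ?_ ?_ ?_ ?_ ?_ ?_ ?_ ?_ ?_ H.augmentation ?_
  · intro j i l m
    rw [LinearEquiv.trans_symm, LinearEquiv.trans_apply, curry₃_symm_single,
      Module.Basis.repr_symm_single, H.basis_apply]
  · intro j i l m
    simp [rmul_apply, H.monomial_mul_y]
  · intro j i l m
    simp [rmul_apply, H.monomial_mul_y]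
  · intro j i l m
    rw [LinearMap.map_smul_of_tower, rmul_apply, H.monomial_mul_x, smul_comm]
    simp
  · intro j i l m
    simp [rmul_apply, monomial_mul_w]
  · intro p
    simp [rmul_apply, mul_assoc, H.y_mul_x]
  · intro p
    simp [rmul_apply, mul_assoc, H.w_mul_y]
  · intro p
    simp [rmul_apply, mul_assoc, H.w_mul_x]
  · intro p
    simp [rmul_apply, mul_assoc, H.w_mul_y]
  · intro p
    simp [rmul_apply, mul_assoc, H.w_mul_x]
  · intro j i l m
    rw [map_smul, H.augmentation_monomial]
    rcases j with _ | j <;> rcases i with _ | i <;> rcases l with _ | l <;> simp [pow_succ]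

theorem isKoszulRegular_rmul (H : IsQuantumSpace 𝒜 lam x y w a b c) :
    IsKoszulRegular (rmul y) (rmul x) (rmul w) (rmul y) (lam • rmul x) :=
  H.isKoszulRegular_rmul_aux.1

theorem augmentation_eq_zero_iff (H : IsQuantumSpace 𝒜 lam x y w a b c) (p : A) :
    H.augmentation p = 0 ↔ ∃ f g h, p = f * y + g * x + h * w := by
  refine ⟨H.isKoszulRegular_rmul_aux.2 p, ?_⟩
  rintro ⟨f, g, h, rfl⟩
  have hy : H.augmentation ∘ₗ (rmul y).restrictScalars 𝕜 = 0 := H.basis.ext fun t => by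
    rw [LinearMap.comp_apply, LinearMap.restrictScalars_apply, rmul_apply, H.basis_apply,
      H.monomial_mul_y, H.augmentation_monomial]
    simp
  have hx : H.augmentation ∘ₗ (rmul x).restrictScalars 𝕜 = 0 := H.basis.ext fun t => by
    rw [LinearMap.comp_apply, LinearMap.restrictScalars_apply, rmul_apply, H.basis_apply,
      H.monomial_mul_x, map_smul, H.augmentation_monomial]
    simp
  have hw : H.augmentation ∘ₗ (rmul w).restrictScalars 𝕜 = 0 := H.basis.ext fun t => by
    rw [LinearMap.comp_apply, LinearMap.restrictScalars_apply, rmul_apply, H.basis_apply,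
      monomial_mul_w, H.augmentation_monomial]
    simp
  rw [map_add, map_add]
  have e1 : H.augmentation (f * y) = 0 := congrArg (fun t => t f) hy
  have e2 : H.augmentation (g * x) = 0 := congrArg (fun t => t g) hx
  have e3 : H.augmentation (h * w) = 0 := congrArg (fun t => t h) hw
  rw [e1, e2, e3, add_zero, add_zero]

theorem linearIndependent_unit_smul {ι : Type*} {M : Type*} [AddCommGroup M] [Module 𝕜 M]
    {f g : ι → M} (hf : LinearIndependent 𝕜 f) (s : ι → 𝕜) (hs : ∀ i, s i ≠ 0)
    (h : ∀ i, g i = s i • f i) : LinearIndependent 𝕜 g := by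
  have : g = (fun i => Units.mk0 (s i) (hs i)) • f := funext fun i => by
    rw [h]; rfl
  rw [this]
  exact hf.units_smul _

theorem span_image_unit_smul {ι : Type*} {M : Type*} [AddCommGroup M] [Module 𝕜 M]
    {f g : ι → M} (s : ι → 𝕜) (hs : ∀ i, s i ≠ 0) (h : ∀ i, g i = s i • f i) (S : Set ι) :
    Submodule.span 𝕜 (g '' S) = Submodule.span 𝕜 (f '' S) := by
  apply le_antisymm <;> rw [Submodule.span_le]
  · rintro _ ⟨i, hi, rfl⟩
    rw [h]
    exact Submodule.smul_mem _ _ (Submodule.subset_span ⟨i, hi, rfl⟩)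
  · rintro _ ⟨i, hi, rfl⟩
    have : f i = (s i)⁻¹ • g i := by rw [h, inv_smul_smul₀ (hs i)]
    rw [this]
    exact Submodule.smul_mem _ _ (Submodule.subset_span ⟨i, hi, rfl⟩)

/-- The opposite algebra is of the same kind, with `λ` inverted. -/
theorem op (H : IsQuantumSpace 𝒜 lam x y w a b c) :
    IsQuantumSpace (opGrading 𝒜) lam⁻¹ (MulOpposite.op x) (MulOpposite.op y) (MulOpposite.op w)
      a b c := by
  have hmon : ∀ t : ℕ × ℕ × ℕ,
      monomial₃ (MulOpposite.op x) (MulOpposite.op y) (MulOpposite.op w) t =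
        lam ^ (t.2.1 * t.1) • (MulOpposite.opLinearEquiv 𝕜 (monomial₃ x y w t)) := by
    rintro ⟨i, j, l⟩
    have h1 : Commute (w ^ l) (x ^ i) := Commute.pow_pow H.w_mul_x l i
    have h2 : Commute (w ^ l) (y ^ j) := Commute.pow_pow H.w_mul_y l j
    rw [← map_smul]
    simp only [monomial₃, MulOpposite.coe_opLinearEquiv, ← MulOpposite.op_pow,
      ← MulOpposite.op_mul]
    congr 1
    rw [H.y_pow_mul_x_pow, mul_smul_comm, ← (h1.mul_right h2).eq]
  have hne : ∀ t : ℕ × ℕ × ℕ, lam ^ (t.2.1 * t.1) ≠ 0 := fun t => pow_ne_zero _ H.lam_ne_zero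
  refine ⟨inv_ne_zero H.lam_ne_zero, ?_, ?_, ?_, H.a_pos, H.b_pos, H.c_pos, ?_, ?_, ?_⟩
  · rw [eq_inv_smul_iff₀ H.lam_ne_zero, ← MulOpposite.op_mul, ← MulOpposite.op_mul, H.y_mul_x,
      MulOpposite.op_smul]
  · rw [← MulOpposite.op_mul, ← MulOpposite.op_mul, H.w_mul_x]
  · rw [← MulOpposite.op_mul, ← MulOpposite.op_mul, H.w_mul_y]
  · refine linearIndependent_unit_smul (f := (MulOpposite.opLinearEquiv 𝕜) ∘ monomial₃ x y w)
      ?_ _ hne hmon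
    exact H.linearIndependent.map' (MulOpposite.opLinearEquiv 𝕜).toLinearMap
      (LinearEquiv.ker _)
  · rw [← Set.image_univ, span_image_unit_smul
      (f := (MulOpposite.opLinearEquiv 𝕜) ∘ monomial₃ x y w) _ hne hmon, Set.image_comp,
      Set.image_univ]
    have := Submodule.map_span (MulOpposite.opLinearEquiv 𝕜 (M := A)).toLinearMap
      (Set.range (monomial₃ x y w))
    rw [LinearEquiv.coe_coe] at this
    rw [← this, top_le_iff.mp H.span_eq_top, Submodule.map_top, LinearEquiv.range]
  · intro d
    rw [opGrading, H.piece_eq, Submodule.map_span, span_image_unit_smul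
      (f := (MulOpposite.opLinearEquiv 𝕜) ∘ monomial₃ x y w) _ hne hmon, Set.image_comp]
    rfl

end IsQuantumSpace

end QuantumSpace

/-! ### Global dimension and self-injective dimension -/

section Dimension

variable {𝕜 : Type u} {A : Type v} [Field 𝕜] [Ring A] [Algebra 𝕜 A]

section Bimodule

variable (𝕜) (M : Type v) [AddCommGroup M] [Module 𝕜 M]

/-- The map `b ⊗ m ↦ b r ⊗ m` of `A ⊗ M`. -/
noncomputable def tensorRight (r : A) : A ⊗[𝕜] M →ₗ[A] A ⊗[𝕜] M :=
  TensorProduct.AlgebraTensorModule.map (rmul r) LinearMap.id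

variable {M} in
theorem tensorRight_tmul (r b : A) (m : M) :
    tensorRight 𝕜 M r (b ⊗ₜ m) = (b * r) ⊗ₜ m := rfl

variable [Module A M] [IsScalarTower 𝕜 A M]

/-- The map `b ⊗ m ↦ b ⊗ r m` of `A ⊗ M`. -/
noncomputable def tensorLeft (r : A) : A ⊗[𝕜] M →ₗ[A] A ⊗[𝕜] M :=
  TensorProduct.AlgebraTensorModule.map LinearMap.id (Algebra.lsmul 𝕜 𝕜 M r)

/-- The action map `b ⊗ m ↦ b m`. -/
noncomputable def tensorAct : A ⊗[𝕜] M →ₗ[A] M :=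
  TensorProduct.AlgebraTensorModule.lift
    (LinearMap.toSpanSingleton A (M →ₗ[𝕜] M) LinearMap.id)

variable {M}

theorem tensorLeft_tmul (r b : A) (m : M) :
    tensorLeft 𝕜 M r (b ⊗ₜ m) = b ⊗ₜ (r • m) := rfl

theorem tensorAct_tmul (b : A) (m : M) : tensorAct 𝕜 M (b ⊗ₜ m) = b • m := rfl

end Bimodule

namespace IsQuantumSpace

variable {𝒜 : ℕ → Submodule 𝕜 A} {lam : 𝕜} {x y w : A} {a b c : ℕ}

/-- The Koszul complex of `A ⊗ M` is a resolution of `M`. -/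
theorem isKoszulRegular_tensor (H : IsQuantumSpace 𝒜 lam x y w a b c) (M : Type v)
    [AddCommGroup M] [Module 𝕜 M] [Module A M] [IsScalarTower 𝕜 A M] :
    IsKoszulRegular (tensorRight 𝕜 M y - tensorLeft 𝕜 M y) (tensorRight 𝕜 M x - tensorLeft 𝕜 M x)
      (tensorRight 𝕜 M w - tensorLeft 𝕜 M w) (tensorRight 𝕜 M y - lam • tensorLeft 𝕜 M y)
      (lam • tensorRight 𝕜 M x - tensorLeft 𝕜 M x) ∧
      ∀ p, tensorAct 𝕜 M p = 0 → ∃ f g h, p = (tensorRight 𝕜 M y - tensorLeft 𝕜 M y) f +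
        (tensorRight 𝕜 M x - tensorLeft 𝕜 M x) g + (tensorRight 𝕜 M w - tensorLeft 𝕜 M w) h := by
  have ext : ∀ f f' g g' : A ⊗[𝕜] M →ₗ[A] A ⊗[𝕜] M,
      (∀ b m, f (f' (b ⊗ₜ m)) = g (g' (b ⊗ₜ m))) → ∀ p, f (f' p) = g (g' p) := by
    intro f f' g g' h p
    induction p with
    | zero => simp
    | tmul b m => exact h b m
    | add p q hp hq => rw [map_add, map_add, map_add, map_add, hp, hq]
  have hyx : ∀ m : M, y • x • m = lam • x • y • m := fun m => by
    rw [← mul_smul, H.y_mul_x, smul_assoc, mul_smul]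
  have hwx : ∀ m : M, w • x • m = x • w • m := fun m => by
    rw [← mul_smul, H.w_mul_x, mul_smul]
  have hwy : ∀ m : M, w • y • m = y • w • m := fun m => by
    rw [← mul_smul, H.w_mul_y, mul_smul]
  refine isKoszulRegular_of_coordinates (M := M) (lam := lam) (x := Algebra.lsmul 𝕜 𝕜 M x)
    (y := Algebra.lsmul 𝕜 𝕜 M y) (w := Algebra.lsmul 𝕜 𝕜 M w)
    hyx hwx hwy
    ((TensorProduct.equivFinsuppOfBasisLeft H.basis).trans (curry₃ 𝕜 M))
    (fun j i l m => monomial₃ x y w (i, j, l) ⊗ₜ m) ?_ ?_ ?_ ?_ ?_ ?_ ?_ ?_ ?_ ?_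
    ((tensorAct 𝕜 M).restrictScalars 𝕜) ?_
  · intro j i l m
    rw [LinearEquiv.trans_symm, LinearEquiv.trans_apply, curry₃_symm_single,
      TensorProduct.equivFinsuppOfBasisLeft_symm_apply, Finsupp.sum_single_index (by simp),
      H.basis_apply]
  · intro j i l m
    simp [tensorRight_tmul, tensorLeft_tmul, H.monomial_mul_y]
  · intro j i l m
    simp [tensorRight_tmul, tensorLeft_tmul, H.monomial_mul_y]
  · intro j i l m
    simp [tensorRight_tmul, tensorLeft_tmul, H.monomial_mul_x, TensorProduct.smul_tmul']
  · intro j i l m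
    simp [tensorRight_tmul, tensorLeft_tmul, monomial_mul_w]
  · refine ext _ _ _ _ fun b m => ?_
    simp only [LinearMap.sub_apply, LinearMap.smul_apply, map_sub,
      tensorRight_tmul, tensorLeft_tmul, mul_assoc, H.y_mul_x, mul_smul_comm, smul_mul_assoc,
      hyx, TensorProduct.smul_tmul', TensorProduct.tmul_smul]
    abel
  · refine ext _ _ _ _ fun b m => ?_
    simp only [LinearMap.sub_apply, map_sub,
      tensorRight_tmul, tensorLeft_tmul, mul_assoc, H.w_mul_y, hwy]
    abel
  · refine ext _ _ _ _ fun b m => ?_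
    simp only [LinearMap.sub_apply, map_sub,
      tensorRight_tmul, tensorLeft_tmul, mul_assoc, H.w_mul_x, hwx]
    abel
  · refine ext _ _ _ _ fun b m => ?_
    simp only [LinearMap.sub_apply, LinearMap.smul_apply, map_sub,
      tensorRight_tmul, tensorLeft_tmul, mul_assoc, H.w_mul_y, hwy,
      TensorProduct.smul_tmul', smul_mul_assoc]
    abel
  · refine ext _ _ _ _ fun b m => ?_
    simp only [LinearMap.sub_apply, LinearMap.smul_apply, map_sub,
      tensorRight_tmul, tensorLeft_tmul, mul_assoc, H.w_mul_x, hwx,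
      TensorProduct.smul_tmul', smul_mul_assoc]
    abel
  · intro j i l m
    have hc : Commute (x ^ i * y ^ j) (w ^ l) :=
      (Commute.pow_pow H.w_mul_x l i).symm.mul_left (Commute.pow_pow H.w_mul_y l j).symm
    rw [← map_pow, ← map_pow, ← map_pow]
    simp only [LinearMap.restrictScalars_apply, tensorAct_tmul, Algebra.lsmul_coe]
    rw [← mul_smul, ← mul_smul, mul_assoc, ← hc.eq, monomial₃]

open CategoryTheory

/-- Every module has projective dimension at most three. -/
theorem hasProjectiveDimensionLT_four (H : IsQuantumSpace 𝒜 lam x y w a b c)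
    (M : ModuleCat.{v} A) : HasProjectiveDimensionLT M 4 := by
  let : Module 𝕜 M := Module.compHom M (algebraMap 𝕜 A)
  have : IsScalarTower 𝕜 A M := IsScalarTower.of_algebraMap_smul fun _ _ => rfl
  obtain ⟨K, hK⟩ := H.isKoszulRegular_tensor M
  refine _root_.hasProjectiveDimensionLT_four (M := M) (ε := tensorAct 𝕜 M)
    K.koszulThree_injective K.exact_three_two K.exact_two_one ?_ ?_
  · intro p
    constructor
    · intro hp
      obtain ⟨f, g, h, rfl⟩ := hK p hp
      exact ⟨![f, g, h], rfl⟩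
    · rintro ⟨f, rfl⟩
      have : ∀ (r : A) (p : A ⊗[𝕜] M),
          tensorAct 𝕜 M ((tensorRight 𝕜 M r - tensorLeft 𝕜 M r) p) = 0 := by
        intro r p
        induction p with
        | zero => simp
        | tmul b m =>
          rw [LinearMap.sub_apply, tensorRight_tmul, tensorLeft_tmul, map_sub, tensorAct_tmul,
            tensorAct_tmul, mul_smul, sub_self]
        | add p q hp hq => rw [map_add, map_add, hp, hq, add_zero]
      rw [koszulOne_apply, map_add, map_add, this, this, this, add_zero, add_zero]
  · exact fun m => ⟨1 ⊗ₜ m, by rw [tensorAct_tmul, one_smul]⟩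

theorem monomial_mem (H : IsQuantumSpace 𝒜 lam x y w a b c) (t : ℕ × ℕ × ℕ) :
    monomial₃ x y w t ∈ 𝒜 (a * t.1 + b * t.2.1 + c * t.2.2) := by
  rw [H.piece_eq]
  exact Submodule.subset_span ⟨t, rfl, rfl⟩

theorem one_mem (H : IsQuantumSpace 𝒜 lam x y w a b c) : (1 : A) ∈ 𝒜 0 := by
  simpa [monomial₃] using H.monomial_mem (0, 0, 0)

theorem x_mem (H : IsQuantumSpace 𝒜 lam x y w a b c) : x ∈ 𝒜 a := by
  simpa [monomial₃] using H.monomial_mem (1, 0, 0)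

theorem y_mem (H : IsQuantumSpace 𝒜 lam x y w a b c) : y ∈ 𝒜 b := by
  simpa [monomial₃] using H.monomial_mem (0, 1, 0)

theorem w_mem (H : IsQuantumSpace 𝒜 lam x y w a b c) : w ∈ 𝒜 c := by
  simpa [monomial₃] using H.monomial_mem (0, 0, 1)

theorem mem_augIdeal_of_mem {d : ℕ} (hd : 0 < d) {p : A} (hp : p ∈ 𝒜 d) : p ∈ augIdeal 𝒜 := by
  obtain ⟨d, rfl⟩ := Nat.exists_eq_succ_of_ne_zero hd.ne'
  exact Ideal.subset_span (Set.mem_iUnion.mpr ⟨d, hp⟩)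

theorem mem_augIdeal_iff (H : IsQuantumSpace 𝒜 lam x y w a b c) (p : A) :
    p ∈ augIdeal 𝒜 ↔ ∃ f g h, p = f * y + g * x + h * w := by
  constructor
  · intro hp
    rw [← H.augmentation_eq_zero_iff]
    induction hp using Submodule.span_induction with
    | mem p hp =>
      obtain ⟨d, hd⟩ := Set.mem_iUnion.mp hp
      have hle : 𝒜 (d + 1) ≤ LinearMap.ker H.augmentation := by
        rw [H.piece_eq, Submodule.span_le]
        rintro _ ⟨t, ht, rfl⟩
        rw [SetLike.mem_coe, LinearMap.mem_ker, H.augmentation_monomial, if_neg]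
        rintro rfl
        simp at ht
      exact hle hd
    | zero => rw [map_zero]
    | add p q _ _ hp hq => rw [map_add, hp, hq, add_zero]
    | smul s p _ hp =>
      obtain ⟨f, g, h, rfl⟩ := (H.augmentation_eq_zero_iff p).mp hp
      refine (H.augmentation_eq_zero_iff _).mpr ⟨s * f, s * g, s * h, ?_⟩
      rw [smul_eq_mul, mul_add, mul_add, mul_assoc, mul_assoc, mul_assoc]
  · rintro ⟨f, g, h, rfl⟩
    exact add_mem (add_mem (Ideal.mul_mem_left _ _ (mem_augIdeal_of_mem H.b_pos H.y_mem))
      (Ideal.mul_mem_left _ _ (mem_augIdeal_of_mem H.a_pos H.x_mem)))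
      (Ideal.mul_mem_left _ _ (mem_augIdeal_of_mem H.c_pos H.w_mem))

theorem exact_koszulOne_mkQ (H : IsQuantumSpace 𝒜 lam x y w a b c) :
    Function.Exact (koszulOne (rmul y) (rmul x) (rmul w)) (augIdeal 𝒜).mkQ := by
  intro p
  rw [Submodule.mkQ_apply, Submodule.Quotient.mk_eq_zero, H.mem_augIdeal_iff]
  constructor
  · rintro ⟨f, g, h, rfl⟩
    exact ⟨![f, g, h], rfl⟩
  · rintro ⟨f, rfl⟩
    exact ⟨f 0, f 1, f 2, rfl⟩

/-- The third extension group of the trivial module with values in `A` is not zero: it is the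
trivial right module, the class of the identity map being a generator. -/
theorem not_subsingleton_ext_three (H : IsQuantumSpace 𝒜 lam x y w a b c) :
    ¬ Subsingleton (Abelian.Ext (ModuleCat.of A (TrivialModule 𝒜)) (ModuleCat.of A A) 3) := by
  intro h
  have K := H.isKoszulRegular_rmul
  obtain ⟨g, hg⟩ := exists_extension_of_subsingleton_ext_three K.koszulThree_injective
    K.exact_three_two K.exact_two_one H.exact_koszulOne_mkQ (Submodule.mkQ_surjective _) h
    LinearMap.id
  have h1 : g ![w, -(lam • x), y] = 1 := by
    have := congrArg (fun t => t 1) hg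
    rw [LinearMap.comp_apply, koszulThree_apply] at this
    simpa [rmul_apply] using this
  have h2 : (![w, -(lam • x), y] : Fin 3 → A) = w • Pi.single 0 1 +
      x • ((-lam) • Pi.single 1 1 : Fin 3 → A) + y • Pi.single 2 1 := by
    ext i; fin_cases i <;> simp
  have hlin : ∀ r s t : Fin 3 → A, g (w • r + x • s + y • t) = w * g r + x * g s + y * g t :=
    fun r s t => by simp
  rw [h2, hlin] at h1
  have h3 : H.op.augmentation 1 = 0 := (H.op.augmentation_eq_zero_iff 1).mpr
    ⟨MulOpposite.op (g (Pi.single 2 1)), MulOpposite.op (g ((-lam) • Pi.single 1 1)),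
      MulOpposite.op (g (Pi.single 0 1)), by
      refine congrArg MulOpposite.op (h1.symm.trans ?_ : (1 : A) = y * g (Pi.single 2 1) +
        x * g ((-lam) • Pi.single 1 1) + w * g (Pi.single 0 1))
      abel⟩
  rw [H.op.augmentation_one] at h3
  exact one_ne_zero h3

theorem leftGlobalDimension_eq (H : IsQuantumSpace 𝒜 lam x y w a b c) :
    leftGlobalDimension A = (3 : ℕ) := by
  apply le_antisymm
  · refine iSup_le fun M => ?_
    rw [projectiveDimension_le_iff]
    exact H.hasProjectiveDimensionLT_four M
  · refine le_trans ?_ (le_iSup _ (ModuleCat.of A (TrivialModule 𝒜)))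
    rw [projectiveDimension_ge_iff]
    intro h
    exact H.not_subsingleton_ext_three (HasProjectiveDimensionLT.subsingleton _ 3 3 le_rfl _)

theorem leftSelfInjectiveDimension_eq (H : IsQuantumSpace 𝒜 lam x y w a b c) :
    leftSelfInjectiveDimension A = (3 : ℕ) := by
  apply le_antisymm
  · rw [leftSelfInjectiveDimension, injectiveDimension_le_iff]
    refine HasInjectiveDimensionLT.mk fun i hi Y e => ?_
    have := H.hasProjectiveDimensionLT_four Y
    exact e.eq_zero_of_hasProjectiveDimensionLT 4 hi
  · rw [leftSelfInjectiveDimension, injectiveDimension_ge_iff]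
    intro h
    exact H.not_subsingleton_ext_three (HasInjectiveDimensionLT.subsingleton _ 3 3 le_rfl _)

end IsQuantumSpace

end Dimension

/-! ### The Koszul resolution of the trivial module and its dual -/

section KoszulResolution

variable {𝕜 : Type u} {A : Type v} [Field 𝕜] [Ring A] [Algebra 𝕜 A]

/-- The ranks of the terms of the Koszul resolution. -/
def koszulRank : ℕ → ℕ
  | 0 => 1
  | 1 => 3
  | 2 => 3
  | 3 => 1
  | _ + 4 => 0

/-- The degrees of the basis vectors of the Koszul resolution. The orders are `y`, `x`, `w` in
the first term and `yx`, `yw`, `xw` in the second one. -/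
def koszulDeg (a b c : ℕ) : ∀ i : ℕ, Fin (koszulRank i) → ℤ
  | 0 => fun _ => 0
  | 1 => ![(b : ℤ), a, c]
  | 2 => ![(a : ℤ) + b, b + c, a + c]
  | 3 => fun _ => a + b + c
  | _ + 4 => fun _ => 0

/-- The differentials of the Koszul resolution. -/
def koszulD (lam : 𝕜) (x y w : A) : ∀ i : ℕ,
    (Fin (koszulRank (i + 1)) → A) →ₗ[A] (Fin (koszulRank i) → A)
  | 0 => LinearMap.pi fun _ => koszulOne (rmul y) (rmul x) (rmul w)
  | 1 => koszulTwo (rmul y) (rmul x) (rmul w) (rmul y) (lam • rmul x)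
  | 2 => koszulThree (rmul w) (rmul y) (lam • rmul x) ∘ₗ
      (LinearMap.proj 0 : (Fin 1 → A) →ₗ[A] A)
  | _ + 3 => 0

theorem mem_intPiece {𝒜 : ℕ → Submodule 𝕜 A} {d : ℕ} {p : A} (hp : p ∈ 𝒜 d) {j : ℤ}
    (hj : j = d) : p ∈ intPiece 𝒜 j := by
  subst hj
  simpa [intPiece] using hp

theorem fin_one_eq_single {R : Type v} [Ring R] (p : Fin 1 → R) : p = p 0 • Pi.single 0 1 := by
  ext i; fin_cases i; simp

theorem fin_three_eq_single {R : Type v} [Ring R] (p : Fin 3 → R) :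
    p = p 0 • Pi.single 0 1 + p 1 • Pi.single 1 1 + p 2 • Pi.single 2 1 := by
  ext i; fin_cases i <;> simp

theorem linearMap_fin_three {R : Type v} [Ring R] (f : (Fin 3 → R) →ₗ[R] R) (p : Fin 3 → R) :
    f p = p 0 * f (Pi.single 0 1) + p 1 * f (Pi.single 1 1) + p 2 * f (Pi.single 2 1) := by
  conv_lhs => rw [fin_three_eq_single p]
  simp

theorem linearMap_fin_one {R : Type v} [Ring R] (f : (Fin 1 → R) →ₗ[R] R) (p : Fin 1 → R) :
    f p = p 0 * f (Pi.single 0 1) := by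
  conv_lhs => rw [fin_one_eq_single p]
  simp

namespace IsQuantumSpace

variable {𝒜 : ℕ → Submodule 𝕜 A} {lam : 𝕜} {x y w : A} {a b c : ℕ}

/-- The Koszul resolution of the trivial module. -/
def resolution (H : IsQuantumSpace 𝒜 lam x y w a b c) : GradedFreeResolution 𝒜 where
  rank := koszulRank
  deg := koszulDeg a b c
  d := koszulD lam x y w
  aug := (augIdeal 𝒜).mkQ ∘ₗ LinearMap.proj (0 : Fin 1)
  d_homogeneous := by
    have hx := H.x_mem
    have hy := H.y_mem
    have hw := H.w_mem
    have zero_mem : ∀ j : ℤ, (0 : A) ∈ intPiece 𝒜 j := fun j => Submodule.zero_mem _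
    rintro (_ | _ | _ | i) r s
    · change Fin 3 at r
      change koszulOne (rmul y) (rmul x) (rmul w) (Pi.single r 1) ∈
        intPiece 𝒜 ((![(b : ℤ), a, c] : Fin 3 → ℤ) r - 0)
      rw [koszulOne_apply]
      fin_cases r <;> simp [rmul_apply]
      · exact mem_intPiece hy rfl
      · exact mem_intPiece hx rfl
      · exact mem_intPiece hw rfl
    · change Fin 3 at r s
      change koszulTwo (rmul y) (rmul x) (rmul w) (rmul y) (lam • rmul x) (Pi.single r 1) s ∈
        intPiece 𝒜 ((![(a : ℤ) + b, b + c, a + c] : Fin 3 → ℤ) r - (![(b : ℤ), a, c] : Fin 3 → ℤ) s)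
      rw [koszulTwo_apply]
      fin_cases r <;> fin_cases s <;> simp [rmul_apply, zero_mem]
      · exact Submodule.smul_mem _ _ (mem_intPiece hx rfl)
      · exact mem_intPiece hy rfl
      · exact mem_intPiece hw rfl
      · exact mem_intPiece hy rfl
      · exact mem_intPiece hw rfl
      · exact mem_intPiece hx rfl
    · change Fin 1 at r
      change Fin 3 at s
      change koszulThree (rmul w) (rmul y) (lam • rmul x) ((Pi.single r 1 : Fin 1 → A) 0) s ∈
        intPiece 𝒜 ((a : ℤ) + b + c - (![(a : ℤ) + b, b + c, a + c] : Fin 3 → ℤ) s)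
      rw [koszulThree_apply]
      fin_cases r
      fin_cases s <;> simp [rmul_apply]
      · exact mem_intPiece hw rfl
      · exact Submodule.smul_mem _ _ (mem_intPiece hx (by ring))
      · exact mem_intPiece hy (by ring)
    · exact Fin.elim0 r
  aug_homogeneous := by
    intro r
    change Fin 1 at r
    fin_cases r
    exact ⟨1, mem_intPiece H.one_mem rfl,
      congrArg (augIdeal 𝒜).mkQ (Pi.single_eq_same (M := fun _ : Fin 1 => A) 0 1).symm⟩
  aug_surjective := (Submodule.mkQ_surjective _).comp fun p => ⟨fun _ => p, rfl⟩
  exact_zero := by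
    intro p
    refine (H.exact_koszulOne_mkQ (p (0 : Fin 1))).trans ?_
    constructor
    · rintro ⟨f, hf⟩
      refine ⟨f, funext fun i => ?_⟩
      change Fin 1 at i
      fin_cases i
      exact hf
    · rintro ⟨f, rfl⟩
      exact ⟨f, rfl⟩
  exact_succ := by
    have K := H.isKoszulRegular_rmul
    rintro (_ | _ | _ | i)
    · intro p
      refine Iff.trans ?_ (K.exact_two_one p)
      constructor
      · intro h
        exact congrFun h (0 : Fin 1)
      · intro h
        exact funext fun _ => h
    · intro p
      refine (K.exact_three_two p).trans ?_
      constructor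
      · rintro ⟨f, rfl⟩
        exact ⟨fun _ => f, rfl⟩
      · rintro ⟨f, rfl⟩
        exact ⟨f (0 : Fin 1), rfl⟩
    · intro p
      constructor
      · intro hp
        have h0 : p (0 : Fin 1) = 0 :=
          K.koszulThree_injective ((hp : koszulThree _ _ _ (p (0 : Fin 1)) = 0).trans
            (map_zero _).symm)
        refine ⟨0, funext fun i => ?_⟩
        change Fin 1 at i
        fin_cases i
        exact h0.symm
      · rintro ⟨f, rfl⟩
        exact map_zero (koszulD lam x y w 2)
    · intro p
      exact ⟨fun _ => ⟨0, funext fun i => Fin.elim0 i⟩, fun _ => rfl⟩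

theorem subsingleton_ext {F : GradedFreeResolution 𝒜} {i : ℕ}
    (h : ∀ f ∈ LinearMap.ker (F.δ i), f ∈ F.coboundaries i) : Subsingleton (F.Ext i) := by
  refine subsingleton_of_forall_eq 0 ?_
  rintro ⟨_, f, hf, rfl⟩
  apply Subtype.ext
  change (F.coboundaries i).mkQ f = 0
  rw [Submodule.mkQ_apply, Submodule.Quotient.mk_eq_zero]
  exact h f hf

/-- The linear form on `A³` with given values on the basis vectors. -/
def formOfValues (p q r : A) : (Fin 3 → A) →ₗ[A] A :=
  rmul p ∘ₗ LinearMap.proj 0 + rmul q ∘ₗ LinearMap.proj 1 + rmul r ∘ₗ LinearMap.proj 2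

theorem formOfValues_apply (p q r : A) (f : Fin 3 → A) :
    formOfValues p q r f = f 0 * p + f 1 * q + f 2 * r := rfl

theorem eq_formOfValues (f : (Fin 3 → A) →ₗ[A] A) :
    f = formOfValues (f (Pi.single 0 1)) (f (Pi.single 1 1)) (f (Pi.single 2 1)) :=
  LinearMap.ext fun p => linearMap_fin_three f p

theorem eq_zero_of_comp_koszulOne (H : IsQuantumSpace 𝒜 lam x y w a b c)
    (f : (Fin 1 → A) →ₗ[A] A)
    (hf : f ∘ₗ LinearMap.pi (fun _ => koszulOne (rmul y) (rmul x) (rmul w)) = 0) : f = 0 := by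
  have h1 := congrArg (fun t => t (Pi.single (0 : Fin 3) (1 : A))) hf
  rw [LinearMap.comp_apply, linearMap_fin_one, LinearMap.pi_apply, koszulOne_apply] at h1
  have h2 : f (Pi.single 0 1) = 0 := by
    refine MulOpposite.op_injective (H.op.isKoszulRegular_rmul.eq_zero _ ?_)
    refine congrArg MulOpposite.op ((?_ : y * f (Pi.single 0 1) = 0))
    simpa [rmul_apply] using h1
  refine LinearMap.ext fun p => ?_
  rw [linearMap_fin_one f, h2, mul_zero, LinearMap.zero_apply]

/-- The dual of the Koszul complex is, up to scalars, the Koszul complex of the opposite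
algebra; so it is exact. -/
theorem exists_eq_comp_koszulOne (H : IsQuantumSpace 𝒜 lam x y w a b c)
    (f : (Fin 3 → A) →ₗ[A] A)
    (hf : f ∘ₗ koszulTwo (rmul y) (rmul x) (rmul w) (rmul y) (lam • rmul x) = 0) :
    ∃ q : A, rmul q ∘ₗ koszulOne (rmul y) (rmul x) (rmul w) = f := by
  rw [eq_formOfValues f] at hf ⊢
  set p₀ := f (Pi.single 0 1)
  set p₁ := f (Pi.single 1 1)
  set p₂ := f (Pi.single 2 1)
  have h0 := congrArg (fun t => t (Pi.single 0 1)) hf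
  have h1 := congrArg (fun t => t (Pi.single 1 1)) hf
  have h2 := congrArg (fun t => t (Pi.single 2 1)) hf
  rw [LinearMap.comp_apply, koszulTwo_apply, formOfValues_apply] at h0 h1 h2
  simp only [rmul_apply, LinearMap.smul_apply, Matrix.cons_val, Pi.single_eq_same, ne_eq,
    Fin.reduceEq, not_false_eq_true, Pi.single_eq_of_ne, one_mul, zero_mul, sub_zero, add_zero,
    zero_add, neg_mul, smul_mul_assoc, smul_zero, neg_zero, zero_sub,
    LinearMap.zero_apply] at h0 h1 h2
  rw [neg_add_eq_zero] at h0 h1 h2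
  obtain ⟨g, hg⟩ := (H.op.isKoszulRegular_rmul.exact_three_two
    ![MulOpposite.op p₂, -(lam⁻¹ • MulOpposite.op p₁), MulOpposite.op p₀]).mp (by
      rw [koszulTwo_apply]
      ext i
      fin_cases i
      · apply MulOpposite.unop_injective
        simp [rmul_apply, h2]
      · apply MulOpposite.unop_injective
        simp [rmul_apply, h1]
      · apply MulOpposite.unop_injective
        simp [rmul_apply, ← h0, H.lam_ne_zero])
  rw [koszulThree_apply] at hg
  have g0 : w * g.unop = p₂ := congrArg MulOpposite.unop (congrFun hg 0)
  have g1 : -(lam⁻¹ • (x * g.unop)) = -(lam⁻¹ • p₁) :=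
    congrArg MulOpposite.unop (congrFun hg 1)
  have g2 : y * g.unop = p₀ := congrArg MulOpposite.unop (congrFun hg 2)
  have g1' : x * g.unop = p₁ := smul_right_injective A (inv_ne_zero H.lam_ne_zero) (neg_inj.mp g1)
  refine ⟨g.unop, LinearMap.ext fun v => ?_⟩
  rw [LinearMap.comp_apply, koszulOne_apply, formOfValues_apply, ← g0, ← g1', ← g2]
  simp only [rmul_apply, add_mul, mul_assoc]

theorem exists_eq_comp_koszulTwo (H : IsQuantumSpace 𝒜 lam x y w a b c)
    (f : (Fin 3 → A) →ₗ[A] A)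
    (hf : f ∘ₗ koszulThree (rmul w) (rmul y) (lam • rmul x) = 0) :
    ∃ g : (Fin 3 → A) →ₗ[A] A,
      g ∘ₗ koszulTwo (rmul y) (rmul x) (rmul w) (rmul y) (lam • rmul x) = f := by
  rw [eq_formOfValues f] at hf ⊢
  set p₀ := f (Pi.single 0 1)
  set p₁ := f (Pi.single 1 1)
  set p₂ := f (Pi.single 2 1)
  have h : w * p₀ - lam • (x * p₁) + y * p₂ = 0 := by
    have := congrArg (fun t => t 1) hf
    rw [LinearMap.comp_apply, koszulThree_apply, formOfValues_apply] at this
    simpa [rmul_apply, sub_eq_add_neg] using this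
  obtain ⟨g, hg⟩ := (H.op.isKoszulRegular_rmul.exact_two_one
    ![MulOpposite.op p₂, -(lam • MulOpposite.op p₁), MulOpposite.op p₀]).mp (by
      rw [koszulOne_apply]
      apply MulOpposite.unop_injective
      simp only [rmul_apply, Matrix.cons_val, MulOpposite.unop_add, MulOpposite.unop_mul,
        MulOpposite.unop_op, MulOpposite.unop_neg, MulOpposite.unop_smul, neg_mul,
        mul_smul_comm, MulOpposite.unop_zero]
      rw [← h]
      abel)
  rw [koszulTwo_apply] at hg
  have g0 : -(lam⁻¹ • (x * (g 0).unop)) - w * (g 1).unop = p₂ :=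
    congrArg MulOpposite.unop (congrFun hg 0)
  have g1 : y * (g 0).unop - w * (g 2).unop = -(lam • p₁) :=
    congrArg MulOpposite.unop (congrFun hg 1)
  have g2 : y * (g 1).unop + x * (g 2).unop = p₀ := congrArg MulOpposite.unop (congrFun hg 2)
  have g1' : p₁ = lam⁻¹ • (w * (g 2).unop - y * (g 0).unop) := by
    rw [eq_inv_smul_iff₀ H.lam_ne_zero, ← neg_sub, g1, neg_neg]
  refine ⟨formOfValues (-(lam⁻¹ • (g 2).unop)) (g 1).unop (-(lam⁻¹ • (g 0).unop)),
    LinearMap.ext fun v => ?_⟩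
  rw [LinearMap.comp_apply, koszulTwo_apply, formOfValues_apply, formOfValues_apply, ← g0, g1',
    ← g2]
  simp only [rmul_apply, LinearMap.smul_apply, Matrix.cons_val, sub_mul, add_mul, mul_add, mul_sub,
    neg_mul, mul_neg, smul_mul_assoc, mul_smul_comm, smul_sub, smul_add, smul_smul, mul_assoc,
    inv_mul_cancel₀ H.lam_ne_zero, one_smul, smul_neg]
  abel

theorem ext_zero (H : IsQuantumSpace 𝒜 lam x y w a b c) :
    Subsingleton (H.resolution.Ext 0) :=
  subsingleton_ext fun f hf => H.eq_zero_of_comp_koszulOne f hf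

theorem ext_one (H : IsQuantumSpace 𝒜 lam x y w a b c) :
    Subsingleton (H.resolution.Ext 1) := by
  refine subsingleton_ext fun f hf => ?_
  obtain ⟨q, hq⟩ := H.exists_eq_comp_koszulOne f hf
  have : (rmul q ∘ₗ (LinearMap.proj 0 : (Fin 1 → A) →ₗ[A] A)) ∘ₗ
    LinearMap.pi (fun _ => koszulOne (rmul y) (rmul x) (rmul w)) = f := hq
  exact ⟨_, this⟩

theorem ext_two (H : IsQuantumSpace 𝒜 lam x y w a b c) :
    Subsingleton (H.resolution.Ext 2) := by
  refine subsingleton_ext fun f hf => ?_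
  have hf' : (f : (Fin 3 → A) →ₗ[A] A) ∘ₗ (koszulThree (rmul w) (rmul y) (lam • rmul x) ∘ₗ
      (LinearMap.proj 0 : (Fin 1 → A) →ₗ[A] A)) = 0 := hf
  exact H.exists_eq_comp_koszulTwo f
    (LinearMap.ext fun p => congrArg (fun t => t (fun _ => p)) hf')

theorem ext_four_le (H : IsQuantumSpace 𝒜 lam x y w a b c) (i : ℕ) :
    Subsingleton (H.resolution.Ext (i + 4)) := by
  refine subsingleton_ext fun f _ => ?_
  have : f = 0 := LinearMap.ext fun v => by
    have hv : v = 0 := funext fun i => Fin.elim0 i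
    rw [hv, map_zero, map_zero]
  rw [this]
  exact Submodule.zero_mem _

/-- The class of the value of a linear form on `A` at the basis vector, in the trivial right
module. -/
def evalClass (𝒜 : ℕ → Submodule 𝕜 A) :
    ((Fin 1 → A) →ₗ[A] A) →ₗ[Aᵐᵒᵖ] TrivialModule (opGrading 𝒜) where
  toFun f := (augIdeal (opGrading 𝒜)).mkQ (MulOpposite.op (f (Pi.single 0 1)))
  map_add' _ _ := rfl
  map_smul' _ _ := rfl

theorem evalClass_apply (f : (Fin 1 → A) →ₗ[A] A) : evalClass 𝒜 f =
    (augIdeal (opGrading 𝒜)).mkQ (MulOpposite.op (f (Pi.single 0 1))) := rfl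

theorem exists_form_eq (r : A) : ∃ f : (Fin 1 → A) →ₗ[A] A, f (Pi.single 0 1) = r :=
  ⟨rmul r ∘ₗ LinearMap.proj 0, by simp [rmul_apply]⟩

theorem evalClass_surjective : Function.Surjective (evalClass 𝒜) := by
  intro q
  obtain ⟨r, rfl⟩ := Submodule.mkQ_surjective _ q
  obtain ⟨f, hf⟩ := exists_form_eq r.unop
  exact ⟨f, by rw [evalClass_apply, hf, MulOpposite.op_unop]⟩

theorem evalClass_eq_zero_iff (H : IsQuantumSpace 𝒜 lam x y w a b c)
    (f : (Fin 1 → A) →ₗ[A] A) : evalClass 𝒜 f = 0 ↔ ∃ g : (Fin 3 → A) →ₗ[A] A,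
      g ∘ₗ koszulThree (rmul w) (rmul y) (lam • rmul x) ∘ₗ
        (LinearMap.proj 0 : (Fin 1 → A) →ₗ[A] A) = f := by
  rw [evalClass_apply, Submodule.mkQ_apply, Submodule.Quotient.mk_eq_zero, H.op.mem_augIdeal_iff]
  constructor
  · rintro ⟨p, q, r, h⟩
    have h' : f (Pi.single 0 1) = y * p.unop + x * q.unop + w * r.unop :=
      congrArg MulOpposite.unop h
    refine ⟨formOfValues r.unop (-(lam⁻¹ • q.unop)) p.unop, LinearMap.ext fun v => ?_⟩
    rw [linearMap_fin_one f, h', LinearMap.comp_apply, LinearMap.comp_apply, koszulThree_apply,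
      formOfValues_apply]
    simp [rmul_apply, H.lam_ne_zero, mul_add, mul_assoc]
    abel
  · rintro ⟨g, rfl⟩
    refine ⟨MulOpposite.op (g (Pi.single 2 1)), MulOpposite.op (-(lam • g (Pi.single 1 1))),
      MulOpposite.op (g (Pi.single 0 1)), ?_⟩
    refine congrArg MulOpposite.op ((?_ : g (koszulThree (rmul w) (rmul y) (lam • rmul x)
      ((Pi.single 0 1 : Fin 1 → A) 0)) = y * g (Pi.single 2 1) +
        x * (-(lam • g (Pi.single 1 1))) + w * g (Pi.single 0 1)))
    rw [koszulThree_apply, linearMap_fin_three]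
    simp [rmul_apply]
    abel

/-- The map `evalClass`, on the cochains of degree three of the Koszul resolution. -/
def evalThree (H : IsQuantumSpace 𝒜 lam x y w a b c) :
    H.resolution.Cochain 3 →ₗ[Aᵐᵒᵖ] TrivialModule (opGrading 𝒜) := evalClass 𝒜

theorem ker_evalThree (H : IsQuantumSpace 𝒜 lam x y w a b c) :
    LinearMap.ker H.evalThree = H.resolution.coboundaries 3 :=
  Submodule.ext fun f => H.evalClass_eq_zero_iff f

theorem ker_δ_three (H : IsQuantumSpace 𝒜 lam x y w a b c) (f : H.resolution.Cochain 3) :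
    f ∈ LinearMap.ker (H.resolution.δ 3) :=
  LinearMap.mem_ker.mpr (LinearMap.ext fun _ => map_zero f)

/-- The third extension group of the trivial module with values in `A` is the trivial right
module. -/
noncomputable def extThreeEquiv (H : IsQuantumSpace 𝒜 lam x y w a b c) :
    H.resolution.Ext 3 ≃ₗ[Aᵐᵒᵖ] TrivialModule (opGrading 𝒜) :=
  (LinearEquiv.ofTop _ (top_le_iff.mp fun q _ => by
    obtain ⟨f, rfl⟩ := Submodule.mkQ_surjective _ q
    exact ⟨f, H.ker_δ_three f, rfl⟩)).trans
  ((Submodule.quotEquivOfEq _ _ H.ker_evalThree.symm).trans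
    (H.evalThree.quotKerEquivOfSurjective evalClass_surjective))

theorem extThreeEquiv_mk (H : IsQuantumSpace 𝒜 lam x y w a b c) (f : H.resolution.Cochain 3)
    (e : H.resolution.Ext 3) (he : (H.resolution.coboundaries 3).mkQ f = e) :
    H.extThreeEquiv e = evalClass 𝒜 f := by
  obtain ⟨e, h⟩ := e
  change _ = e at he
  subst he
  rfl

theorem mem_intPiece_opGrading (j : ℤ) (p : A) :
    MulOpposite.op p ∈ intPiece (opGrading 𝒜) j ↔ p ∈ intPiece 𝒜 j := by
  unfold intPiece
  split_ifs
  · constructor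
    · rintro ⟨q, hq, h⟩
      exact (MulOpposite.op_injective h) ▸ hq
    · exact fun h => ⟨p, h, rfl⟩
  · simp

theorem hasASExt (H : IsQuantumSpace 𝒜 lam x y w a b c) :
    HasASExt 𝒜 3 ((a : ℤ) + b + c) := by
  refine ⟨H.resolution, ?_, H.extThreeEquiv, ?_⟩
  · rintro (_ | _ | _ | _ | i) hi
    · exact H.ext_zero
    · exact H.ext_one
    · exact H.ext_two
    · exact absurd rfl hi
    · exact H.ext_four_le i
  · intro j
    ext q
    constructor
    · rintro ⟨e, ⟨f, -, hf, he⟩, rfl⟩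
      rw [H.extThreeEquiv_mk f e he]
      exact ⟨_, (mem_intPiece_opGrading _ _).mpr (hf (0 : Fin 1)), rfl⟩
    · rintro ⟨r, hr, rfl⟩
      obtain ⟨f, hf⟩ := exists_form_eq r.unop
      refine ⟨⟨(H.resolution.coboundaries 3).mkQ f, f, H.ker_δ_three f, rfl⟩,
        ⟨f, H.ker_δ_three f, ?_, rfl⟩, ?_⟩
      · intro i
        change Fin 1 at i
        fin_cases i
        change f (Pi.single 0 1) ∈ intPiece 𝒜 ((a : ℤ) + b + c + j)
        rw [hf, ← mem_intPiece_opGrading]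
        exact hr
      · rw [H.extThreeEquiv_mk f _ rfl, evalClass_apply, hf, MulOpposite.op_unop]

end IsQuantumSpace

end KoszulResolution

/-! ### The grading and the growth -/

section Growth

variable {𝕜 : Type u} {A : Type v} [Field 𝕜] [Ring A] [Algebra 𝕜 A]

namespace IsQuantumSpace

variable {𝒜 : ℕ → Submodule 𝕜 A} {lam : 𝕜} {x y w : A} {a b c : ℕ}

theorem monomial_mul_monomial (H : IsQuantumSpace 𝒜 lam x y w a b c) (s t : ℕ × ℕ × ℕ) :
    monomial₃ x y w s * monomial₃ x y w t =
      lam ^ (s.2.1 * t.1) • monomial₃ x y w (s + t) := by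
  obtain ⟨i, j, l⟩ := s
  obtain ⟨i', j', l'⟩ := t
  have h1 : Commute (w ^ l) (x ^ i' * y ^ j') :=
    (Commute.pow_pow H.w_mul_x l i').mul_right (Commute.pow_pow H.w_mul_y l j')
  calc x ^ i * y ^ j * w ^ l * (x ^ i' * y ^ j' * w ^ l')
      = x ^ i * (y ^ j * x ^ i') * (y ^ j' * w ^ l * w ^ l') := by
        rw [mul_assoc (x ^ i * y ^ j), ← mul_assoc (w ^ l), h1.eq]
        simp only [mul_assoc]
    _ = _ := by
        rw [H.y_pow_mul_x_pow]
        simp only [monomial₃, Prod.mk_add_mk, pow_add, mul_smul_comm, smul_mul_assoc, mul_assoc]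

theorem span_image_mul_le (H : IsQuantumSpace 𝒜 lam x y w a b c) {S T U : Set (ℕ × ℕ × ℕ)}
    (h : ∀ s ∈ S, ∀ t ∈ T, s + t ∈ U) :
    Submodule.span 𝕜 (monomial₃ x y w '' S) * Submodule.span 𝕜 (monomial₃ x y w '' T) ≤
      Submodule.span 𝕜 (monomial₃ x y w '' U) := by
  rw [Submodule.span_mul_span, Submodule.span_le]
  rintro _ ⟨_, ⟨s, hs, rfl⟩, _, ⟨t, ht, rfl⟩, rfl⟩
  simp only [H.monomial_mul_monomial]
  exact Submodule.smul_mem _ _ (Submodule.subset_span ⟨_, h s hs t ht, rfl⟩)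

theorem isConnectedGrading (H : IsQuantumSpace 𝒜 lam x y w a b c) : IsConnectedGrading 𝒜 where
  gradedMonoid :=
    { one_mem := H.one_mem
      mul_mem := by
        intro d e p q hp hq
        rw [H.piece_eq] at hp hq ⊢
        refine H.span_image_mul_le ?_ (Submodule.mul_mem_mul hp hq)
        intro s hs t ht
        simp only [Set.mem_ofPred_eq, Prod.fst_add, Prod.snd_add] at hs ht ⊢
        rw [← hs, ← ht]
        ring }
  isInternal := by
    rw [DirectSum.isInternal_submodule_iff_iSupIndep_and_iSup_eq_top]
    constructor
    · intro d
      have : ⨆ (e) (_ : e ≠ d), 𝒜 e ≤ Submodule.span 𝕜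
          (monomial₃ x y w '' {t | a * t.1 + b * t.2.1 + c * t.2.2 ≠ d}) := by
        refine iSup₂_le fun e he => ?_
        rw [H.piece_eq]
        refine Submodule.span_mono (Set.image_mono fun t ht => ?_)
        rw [Set.mem_ofPred_eq] at ht ⊢
        rwa [ht]
      refine Disjoint.mono_right this ?_
      rw [H.piece_eq]
      refine H.linearIndependent.disjoint_span_image ?_
      exact Set.disjoint_left.mpr fun t h1 h2 => h2 h1
    · rw [← top_le_iff, ← top_le_iff.mp H.span_eq_top, Submodule.span_le]
      rintro _ ⟨t, rfl⟩
      exact Submodule.mem_iSup_of_mem _ (H.monomial_mem t)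
  nontrivial := ⟨1, 0, fun h => one_ne_zero (α := 𝕜) (by
    rw [← H.augmentation_one, h, map_zero])⟩
  zero_eq := by
    rw [H.piece_eq, Submodule.one_eq_span]
    congr 1
    have : {t : ℕ × ℕ × ℕ | a * t.1 + b * t.2.1 + c * t.2.2 = 0} = {(0, 0, 0)} := by
      ext ⟨i, j, l⟩
      simp [H.a_pos.ne', H.b_pos.ne', H.c_pos.ne', and_assoc]
    rw [this]
    simp [monomial₃]

/-- The span of the monomials with exponents at most `N`. -/
def box (𝕜 : Type u) [Field 𝕜] [Algebra 𝕜 A] (x y w : A) (N : ℕ) : Submodule 𝕜 A :=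
  Submodule.span 𝕜 (monomial₃ x y w '' {t | t.1 ≤ N ∧ t.2.1 ≤ N ∧ t.2.2 ≤ N})

theorem box_mono {M N : ℕ} (h : M ≤ N) : box 𝕜 x y w M ≤ box 𝕜 x y w N :=
  Submodule.span_mono (Set.image_mono fun _ ht =>
    ⟨ht.1.trans h, ht.2.1.trans h, ht.2.2.trans h⟩)

theorem exists_mem_box (H : IsQuantumSpace 𝒜 lam x y w a b c) (p : A) :
    ∃ N, p ∈ box 𝕜 x y w N := by
  have hp := H.span_eq_top (Submodule.mem_top (x := p))
  induction hp using Submodule.span_induction with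
  | mem p hp =>
    obtain ⟨t, rfl⟩ := hp
    refine ⟨t.1 + t.2.1 + t.2.2, Submodule.subset_span ⟨t, ⟨?_, ?_, ?_⟩, rfl⟩⟩ <;> omega
  | zero => exact ⟨0, Submodule.zero_mem _⟩
  | add p q _ _ hp hq =>
    obtain ⟨M, hM⟩ := hp
    obtain ⟨N, hN⟩ := hq
    exact ⟨max M N, add_mem (box_mono (le_max_left _ _) hM) (box_mono (le_max_right _ _) hN)⟩
  | smul s p _ hp =>
    obtain ⟨M, hM⟩ := hp
    exact ⟨M, Submodule.smul_mem _ _ hM⟩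

theorem exists_le_box (H : IsQuantumSpace 𝒜 lam x y w a b c) {V : Submodule 𝕜 A} (hV : V.FG) :
    ∃ N, V ≤ box 𝕜 x y w N := by
  obtain ⟨S, rfl⟩ := hV
  choose N hN using H.exists_mem_box
  refine ⟨S.sup N, Submodule.span_le.mpr fun s hs => ?_⟩
  exact box_mono (Finset.le_sup (f := N) hs) (hN s)

theorem pow_le_box (H : IsQuantumSpace 𝒜 lam x y w a b c) {V : Submodule 𝕜 A} {N : ℕ}
    (hV : V ≤ box 𝕜 x y w N) (m : ℕ) : V ^ m ≤ box 𝕜 x y w (N * m) := by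
  induction m with
  | zero =>
    rw [pow_zero, Submodule.one_le]
    exact Submodule.subset_span ⟨(0, 0, 0), by simp, by simp [monomial₃]⟩
  | succ m ih =>
    rw [pow_succ]
    refine (mul_le_mul' ih hV).trans (H.span_image_mul_le ?_)
    rintro s ⟨h1, h2, h3⟩ t ⟨h4, h5, h6⟩
    rw [mul_add, mul_one]
    exact ⟨add_le_add h1 h4, add_le_add h2 h5, add_le_add h3 h6⟩

theorem finrank_le_of_le_box {V : Submodule 𝕜 A} {N : ℕ} (hV : V ≤ box 𝕜 x y w N) :
    Module.finrank 𝕜 V ≤ (N + 1) ^ 3 := by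
  classical
  let S : Finset A := ((Finset.range (N + 1)) ×ˢ (Finset.range (N + 1)) ×ˢ
    (Finset.range (N + 1))).image (monomial₃ x y w)
  have hS : box 𝕜 x y w N ≤ Submodule.span 𝕜 (S : Set A) := by
    refine Submodule.span_mono ?_
    rintro _ ⟨t, ⟨h1, h2, h3⟩, rfl⟩
    refine Finset.mem_coe.mpr (Finset.mem_image_of_mem _ ?_)
    simp only [Finset.mem_product, Finset.mem_range]
    omega
  calc Module.finrank 𝕜 V ≤ Module.finrank 𝕜 (Submodule.span 𝕜 (S : Set A)) :=
        Submodule.finrank_mono (hV.trans hS)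
    _ ≤ S.card := finrank_span_finset_le_card S
    _ ≤ _ := Finset.card_image_le
    _ = (N + 1) ^ 3 := by
        simp only [Finset.card_product, Finset.card_range]
        ring

/-- The dimension is at most `6`; a bound as crude as this suffices here. -/
theorem gkDim_lt_top (H : IsQuantumSpace 𝒜 lam x y w a b c) : gkDim 𝕜 A < ⊤ := by
  refine lt_of_le_of_lt ?_ (EReal.coe_lt_top 6)
  refine iSup_le fun V => ?_
  obtain ⟨N, hN⟩ := H.exists_le_box V.2
  refine Filter.limsup_le_of_le (h := ?_)
  filter_upwards [Filter.eventually_ge_atTop (N + 2)] with m hm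
  rw [EReal.coe_le_coe_iff]
  have hle : (⨆ i : Fin (m + 1), (V : Submodule 𝕜 A) ^ (i : ℕ) : Submodule 𝕜 A) ≤
      box 𝕜 x y w (N * m) :=
    iSup_le fun i => (H.pow_le_box hN i).trans
      (box_mono (Nat.mul_le_mul_left N (Nat.lt_succ_iff.mp i.2)))
  have hrank := finrank_le_of_le_box hle
  -- For `m > N` the box has side `N m + 1 ≤ m²`.
  have hside : N * m + 1 ≤ m ^ 2 := by nlinarith
  have hm1 : (1 : ℝ) < m := by exact_mod_cast (by omega : 1 < m)
  have hlog : 0 < Real.log m := Real.log_pos hm1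
  rw [div_le_iff₀ hlog]
  rcases Nat.eq_zero_or_pos (Module.finrank 𝕜
    (⨆ i : Fin (m + 1), (V : Submodule 𝕜 A) ^ (i : ℕ) : Submodule 𝕜 A)) with h0 | h0
  · rw [h0, Nat.cast_zero, Real.log_zero]
    positivity
  · have h6 : Module.finrank 𝕜
        (⨆ i : Fin (m + 1), (V : Submodule 𝕜 A) ^ (i : ℕ) : Submodule 𝕜 A) ≤ m ^ 6 :=
      hrank.trans ((Nat.pow_le_pow_left hside 3).trans (by rw [← pow_mul]))
    calc Real.log _ ≤ Real.log ((m : ℝ) ^ 6) :=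
          Real.log_le_log (by exact_mod_cast h0) (by exact_mod_cast h6)
      _ = 6 * Real.log m := by rw [Real.log_pow]; norm_num

theorem isASRegular (H : IsQuantumSpace 𝒜 lam x y w a b c) : IsASRegular 𝒜 :=
  ⟨3, { connected := H.isConnectedGrading
        injDim_left := H.leftSelfInjectiveDimension_eq
        injDim_right := H.op.leftSelfInjectiveDimension_eq
        ext := ⟨_, H.hasASExt, H.op.hasASExt⟩
        glDim_left := H.leftGlobalDimension_eq
        glDim_right := H.op.leftGlobalDimension_eq
        gkDim_lt_top := H.gkDim_lt_top }⟩

end IsQuantumSpace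

end Growth

/-! ### Skew polynomial rings in three variables -/

section SkewPoly

variable {𝕜 : Type u} {A : Type v} [Field 𝕜] [Ring A] [Algebra 𝕜 A]

/-- In an algebra generated by `f`, a subspace that contains `1` and is stable under left
multiplication by the generators is everything. -/
theorem mem_of_left_stable {ι : Type*} (φ : FreeAlgebra 𝕜 ι →ₐ[𝕜] A)
    (hφ : Function.Surjective φ) (S : Submodule 𝕜 A) (h1 : (1 : A) ∈ S)
    (hmul : ∀ i, ∀ s ∈ S, φ (FreeAlgebra.ι 𝕜 i) * s ∈ S) (p : A) : p ∈ S := by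
  obtain ⟨f, rfl⟩ := hφ p
  have key : ∀ f : FreeAlgebra 𝕜 ι, ∀ s ∈ S, φ f * s ∈ S := by
    intro f
    induction f using FreeAlgebra.induction with
    | grade0 r =>
      intro s hs
      rw [AlgHom.commutes, ← Algebra.smul_def]
      exact S.smul_mem r hs
    | grade1 i => exact hmul i
    | mul f g hf hg =>
      intro s hs
      rw [map_mul, mul_assoc]
      exact hf _ (hg s hs)
    | add f g hf hg =>
      intro s hs
      rw [map_add, add_mul]
      exact add_mem (hf s hs) (hg s hs)
  simpa using key f 1 h1

namespace SkewPolyRing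

variable {q : Matrix (Fin 3) (Fin 3) 𝕜}

theorem X_mul_X {i j : Fin 3} (hij : i < j) : X q j * X q i = q i j • (X q i * X q j) := by
  have := RingQuot.mkAlgHom_rel 𝕜 (SkewPolyRel.comm (q := q) i j hij)
  rwa [map_smul, map_mul, map_mul] at this

theorem span_monomials : ⊤ ≤ Submodule.span 𝕜
    (Set.range (monomial₃ (X q 0) (X q 1) (X q 2))) := by
  intro p _
  set S := Submodule.span 𝕜 (Set.range (monomial₃ (X q 0) (X q 1) (X q 2)))
  refine mem_of_left_stable (RingQuot.mkAlgHom 𝕜 (SkewPolyRel q))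
    (RingQuot.mkAlgHom_surjective _ _) S (Submodule.subset_span ⟨(0, 0, 0), by simp [monomial₃]⟩)
    ?_ p
  intro m s hs
  change X q m * s ∈ _
  induction hs using Submodule.span_induction with
  | mem s hs =>
    obtain ⟨⟨i, j, l⟩, rfl⟩ := hs
    have h10 := qcomm_pow (X_mul_X (q := q) (show (0 : Fin 3) < 1 by decide)) i
    have h20 := qcomm_pow (X_mul_X (q := q) (show (0 : Fin 3) < 2 by decide)) i
    have h21 := qcomm_pow (X_mul_X (q := q) (show (1 : Fin 3) < 2 by decide)) j
    fin_cases m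
    · refine Submodule.subset_span ⟨(i + 1, j, l), ?_⟩
      simp [monomial₃, pow_succ', mul_assoc]
    · have : X q 1 * monomial₃ (X q 0) (X q 1) (X q 2) (i, j, l) =
          q 0 1 ^ i • monomial₃ (X q 0) (X q 1) (X q 2) (i, j + 1, l) := by
        simp only [monomial₃]
        rw [← mul_assoc, ← mul_assoc, h10]
        simp only [smul_mul_assoc, mul_assoc, pow_succ']
      exact Eq.subst (motive := (· ∈ S)) this.symm
        (Submodule.smul_mem _ _ (Submodule.subset_span ⟨_, rfl⟩))
    · have : X q 2 * monomial₃ (X q 0) (X q 1) (X q 2) (i, j, l) =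
          (q 0 2 ^ i * q 1 2 ^ j) • monomial₃ (X q 0) (X q 1) (X q 2) (i, j, l + 1) := by
        simp only [monomial₃]
        rw [← mul_assoc, ← mul_assoc, h20, smul_mul_assoc, mul_assoc (X q 0 ^ i), h21]
        simp only [smul_mul_assoc, mul_smul_comm, mul_assoc, pow_succ', smul_smul]
      exact Eq.subst (motive := (· ∈ S)) this.symm
        (Submodule.smul_mem _ _ (Submodule.subset_span ⟨_, rfl⟩))
  | zero => rw [mul_zero]; exact Submodule.zero_mem _
  | add s t _ _ hs ht => rw [mul_add]; exact add_mem hs ht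
  | smul r s _ hs => rw [mul_smul_comm]; exact Submodule.smul_mem _ _ hs

/-- The universal property of a skew polynomial ring in three variables. -/
def lift₃ (x y w : A) (h01 : y * x = q 0 1 • (x * y)) (h02 : w * x = q 0 2 • (x * w))
    (h12 : w * y = q 1 2 • (y * w)) : SkewPolyRing q →ₐ[𝕜] A :=
  RingQuot.liftAlgHom 𝕜 ⟨FreeAlgebra.lift 𝕜 ![x, y, w], by
    rintro _ _ ⟨i, j, hij⟩
    fin_cases i <;> fin_cases j <;> simp at hij ⊢ <;> assumption⟩

theorem lift₃_X (x y w : A) (h01 : y * x = q 0 1 • (x * y)) (h02 : w * x = q 0 2 • (x * w))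
    (h12 : w * y = q 1 2 • (y * w)) (i : Fin 3) :
    lift₃ x y w h01 h02 h12 (X q i) = ![x, y, w] i :=
  (RingQuot.liftAlgHom_mkAlgHom_apply (S := 𝕜) _ _ _).trans (FreeAlgebra.lift_ι_apply _ _)

end SkewPolyRing

theorem map_monomial₃ {B : Type w} [Ring B] [Algebra 𝕜 B] (φ : A →ₐ[𝕜] B) (x y w : A)
    (t : ℕ × ℕ × ℕ) : φ (monomial₃ x y w t) = monomial₃ (φ x) (φ y) (φ w) t := by
  simp [monomial₃]

theorem IsQuantumSpace.exists_skewPolyRing_equiv {𝒜 : ℕ → Submodule 𝕜 A} {lam : 𝕜} {x y w : A}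
    {a b c : ℕ} (H : IsQuantumSpace 𝒜 lam x y w a b c) (q : Matrix (Fin 3) (Fin 3) 𝕜)
    (h01 : q 0 1 = lam) (h02 : q 0 2 = 1) (h12 : q 1 2 = 1) :
    ∃ e : SkewPolyRing q ≃ₐ[𝕜] A, e (SkewPolyRing.X q 0) = x ∧ e (SkewPolyRing.X q 1) = y ∧
      e (SkewPolyRing.X q 2) = w := by
  let φ : SkewPolyRing q →ₐ[𝕜] A := SkewPolyRing.lift₃ x y w (by rw [h01, H.y_mul_x])
    (by rw [h02, one_smul, H.w_mul_x]) (by rw [h12, one_smul, H.w_mul_y])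
  have hφ : ∀ i, φ (SkewPolyRing.X q i) = ![x, y, w] i :=
    fun i => SkewPolyRing.lift₃_X _ _ _ _ _ _ i
  have hmon : ∀ t, φ (monomial₃ (SkewPolyRing.X q 0) (SkewPolyRing.X q 1) (SkewPolyRing.X q 2) t) =
      monomial₃ x y w t := fun t => by
    rw [map_monomial₃, hφ, hφ, hφ]
    rfl
  have hbij : Function.Bijective φ := by
    constructor
    · rw [injective_iff_map_eq_zero]
      intro p hp
      have hmem := SkewPolyRing.span_monomials (Submodule.mem_top (x := p))
      rw [← Finsupp.range_linearCombination] at hmem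
      obtain ⟨f, rfl⟩ := hmem
      have h0 : Finsupp.linearCombination 𝕜 (monomial₃ x y w) f = 0 := by
        rw [← hp, ← AlgHom.coe_toLinearMap, Finsupp.apply_linearCombination]
        congr 2
        exact funext fun t => (hmon t).symm
      rw [linearIndependent_iff.mp H.linearIndependent f h0, map_zero]
    · intro p
      have hle : ⊤ ≤ LinearMap.range φ.toLinearMap := H.span_eq_top.trans (by
        rw [Submodule.span_le]
        rintro _ ⟨t, rfl⟩
        exact ⟨_, hmon t⟩)
      exact hle Submodule.mem_top
  exact ⟨AlgEquiv.ofBijective φ hbij, hφ 0, hφ 1, hφ 2⟩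

end SkewPoly

/-! ### The Poincaré–Birkhoff–Witt basis of a down-up algebra -/

section DownUpBasis

variable {𝕜 : Type u} [Field 𝕜]

/-- The numbers `∑ pᵃ rᵇ`, the sum being over `a + b = i - 1`. -/
def mixedSum (p r : 𝕜) : ℕ → 𝕜
  | 0 => 0
  | i + 1 => p ^ i + r * mixedSum p r i

theorem mixedSum_succ (p r : 𝕜) (i : ℕ) :
    mixedSum p r (i + 1) = p ^ i + r * mixedSum p r i := rfl

theorem mixedSum_succ' (p r : 𝕜) (i : ℕ) :
    mixedSum p r (i + 1) = r ^ i + p * mixedSum p r i := by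
  induction i with
  | zero => simp [mixedSum]
  | succ i ih =>
    rw [mixedSum_succ p r (i + 1)]
    linear_combination r * ih - p * mixedSum_succ p r i

theorem sub_mul_mixedSum (p r : 𝕜) (i : ℕ) : (p - r) * mixedSum p r i = p ^ i - r ^ i := by
  induction i with
  | zero => simp [mixedSum]
  | succ i ih =>
    rw [mixedSum_succ]
    linear_combination r * ih

namespace DownUp

section Relations

variable {α β : 𝕜}

theorem v_v_u : v α β * v α β * u α β =
    α • (v α β * u α β * v α β) + β • (u α β * v α β * v α β) := by
  have := RingQuot.mkAlgHom_rel 𝕜 (DownUpRel.vvu (α := α) (β := β))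
  simpa [u, v, pow_two, mul_assoc] using this

theorem v_u_u : v α β * u α β * u α β =
    α • (u α β * v α β * u α β) + β • (u α β * u α β * v α β) := by
  have := RingQuot.mkAlgHom_rel 𝕜 (DownUpRel.vuu (α := α) (β := β))
  simpa [u, v, pow_two, mul_assoc] using this

/-- The universal property of a down-up algebra. -/
def lift {B : Type w} [Ring B] [Algebra 𝕜 B] (U V : B)
    (h1 : V * V * U = α • (V * U * V) + β • (U * V * V))
    (h2 : V * U * U = α • (U * V * U) + β • (U * U * V)) : DownUp α β →ₐ[𝕜] B :=
  RingQuot.liftAlgHom 𝕜 ⟨FreeAlgebra.lift 𝕜 (fun t => DownUpGen.casesOn t U V), by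
    rintro _ _ (_ | _)
    · simpa [pow_two, mul_assoc] using h1
    · simpa [pow_two, mul_assoc] using h2⟩

theorem lift_u {B : Type w} [Ring B] [Algebra 𝕜 B] (U V : B)
    (h1 : V * V * U = α • (V * U * V) + β • (U * V * V))
    (h2 : V * U * U = α • (U * V * U) + β • (U * U * V)) : lift U V h1 h2 (u α β) = U :=
  (RingQuot.liftAlgHom_mkAlgHom_apply (S := 𝕜) _ _ _).trans (FreeAlgebra.lift_ι_apply _ _)

theorem lift_v {B : Type w} [Ring B] [Algebra 𝕜 B] (U V : B)
    (h1 : V * V * U = α • (V * U * V) + β • (U * V * V))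
    (h2 : V * U * U = α • (U * V * U) + β • (U * U * V)) : lift U V h1 h2 (v α β) = V :=
  (RingQuot.liftAlgHom_mkAlgHom_apply (S := 𝕜) _ _ _).trans (FreeAlgebra.lift_ι_apply _ _)

/-- The relations of a down-up algebra follow from `V U = p U V + Z` and a commutation rule of `Z`,
when `t² - α t - β = (t - p) (t - r)`. -/
theorem v_v_u_of_normal {B : Type w} [Ring B] [Algebra 𝕜 B] {p r : 𝕜} {U V Z : B}
    (h1 : V * U = p • (U * V) + Z) (h2 : V * Z = r • (Z * V)) (hα : α = p + r)
    (hβ : β = -(p * r)) : V * V * U = α • (V * U * V) + β • (U * V * V) := by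
  have hz : Z = V * U - p • (U * V) := by rw [h1]; abel
  rw [hz, mul_sub, sub_mul, mul_smul_comm, smul_mul_assoc, ← mul_assoc, ← mul_assoc,
    sub_eq_iff_eq_add] at h2
  rw [h2, hα, hβ]
  module

theorem v_u_u_of_normal {B : Type w} [Ring B] [Algebra 𝕜 B] {p r : 𝕜} {U V Z : B}
    (h1 : V * U = p • (U * V) + Z) (h2 : Z * U = r • (U * Z)) (hα : α = p + r)
    (hβ : β = -(p * r)) : V * U * U = α • (U * V * U) + β • (U * U * V) := by
  have hz : Z = V * U - p • (U * V) := by rw [h1]; abel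
  rw [hz, mul_sub, sub_mul, mul_smul_comm, smul_mul_assoc, ← mul_assoc, ← mul_assoc,
    sub_eq_iff_eq_add] at h2
  rw [h2, hα, hβ]
  module

variable (α β) in
/-- The element `z = v u - p u v`, which is normal when `p` is a root of `t² - α t - β`. -/
def z (p : 𝕜) : DownUp α β := v α β * u α β - p • (u α β * v α β)

variable {p r : 𝕜}

theorem v_mul_u : v α β * u α β = p • (u α β * v α β) + z α β p := by
  rw [z]; abel

theorem v_mul_z (hα : α = p + r) (hβ : β = -(p * r)) :
    v α β * z α β p = r • (z α β p * v α β) := by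
  rw [z, mul_sub, ← mul_assoc, v_v_u, mul_smul_comm, ← mul_assoc, sub_mul, smul_mul_assoc]
  generalize v α β * u α β * v α β = s
  generalize u α β * v α β * v α β = t
  subst hα hβ
  module

theorem z_mul_u (hα : α = p + r) (hβ : β = -(p * r)) :
    z α β p * u α β = r • (u α β * z α β p) := by
  rw [z, sub_mul, v_u_u, smul_mul_assoc, mul_sub, ← mul_assoc, mul_smul_comm, ← mul_assoc]
  generalize u α β * v α β * u α β = s
  generalize u α β * u α β * v α β = t
  subst hα hβ
  module

theorem v_mul_z_pow (hα : α = p + r) (hβ : β = -(p * r)) (j : ℕ) :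
    v α β * z α β p ^ j = r ^ j • (z α β p ^ j * v α β) := qcomm_pow (v_mul_z hα hβ) j

theorem z_pow_mul_u (hα : α = p + r) (hβ : β = -(p * r)) (j : ℕ) :
    z α β p ^ j * u α β = r ^ j • (u α β * z α β p ^ j) := by
  induction j with
  | zero => simp
  | succ j ih =>
    rw [pow_succ', mul_assoc, ih, mul_smul_comm, ← mul_assoc, z_mul_u hα hβ, smul_mul_assoc,
      smul_smul, mul_assoc, ← pow_succ]

theorem v_mul_u_pow (hα : α = p + r) (hβ : β = -(p * r)) (i : ℕ) : v α β * u α β ^ (i + 1) =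
    p ^ (i + 1) • (u α β ^ (i + 1) * v α β) +
      mixedSum p r (i + 1) • (u α β ^ i * z α β p) := by
  induction i with
  | zero => simpa [mixedSum] using v_mul_u
  | succ i ih =>
    rw [pow_succ (u α β) (i + 1), ← mul_assoc, ih, add_mul, smul_mul_assoc, smul_mul_assoc,
      mul_assoc, v_mul_u (p := p), mul_assoc (u α β ^ i), z_mul_u hα hβ, mixedSum_succ p r (i + 1)]
    simp only [mul_add, mul_smul_comm, ← mul_assoc, ← pow_succ]
    module

theorem v_pow_mul_u (hα : α = p + r) (hβ : β = -(p * r)) (l : ℕ) : v α β ^ (l + 1) * u α β =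
    p ^ (l + 1) • (u α β * v α β ^ (l + 1)) +
      mixedSum p r (l + 1) • (z α β p * v α β ^ l) := by
  induction l with
  | zero => simpa [mixedSum] using v_mul_u
  | succ l ih =>
    rw [pow_succ' (v α β) (l + 1), mul_assoc, ih, mul_add, mul_smul_comm, mul_smul_comm,
      ← mul_assoc, v_mul_u (p := p), ← mul_assoc, v_mul_z hα hβ, mixedSum_succ p r (l + 1)]
    simp only [add_mul, smul_mul_assoc, mul_assoc, ← pow_succ']
    module

theorem v_mul_monomial (hα : α = p + r) (hβ : β = -(p * r)) (i j l : ℕ) :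
    v α β * monomial₃ (u α β) (z α β p) (v α β) (i, j, l) =
      (p ^ i * r ^ j) • monomial₃ (u α β) (z α β p) (v α β) (i, j, l + 1) +
        mixedSum p r i • monomial₃ (u α β) (z α β p) (v α β) (i - 1, j + 1, l) := by
  rcases i with _ | i
  · simp only [monomial₃, pow_zero, one_mul, mixedSum, zero_smul, add_zero]
    rw [← mul_assoc, v_mul_z_pow hα hβ, smul_mul_assoc, mul_assoc, ← pow_succ']
  · simp only [monomial₃, Nat.add_sub_cancel]
    rw [← mul_assoc, ← mul_assoc, v_mul_u_pow hα hβ, add_mul, smul_mul_assoc, mul_assoc _ (v α β),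
      v_mul_z_pow hα hβ]
    simp only [add_mul, smul_mul_assoc, mul_smul_comm, smul_smul, mul_assoc, pow_succ']

end Relations

section Representation

variable (p r : 𝕜)

/-- The action of `u` in the representation on the space with basis `uⁱ zʲ vˡ`. -/
noncomputable def opU : Module.End 𝕜 (ℕ × ℕ × ℕ →₀ 𝕜) :=
  Finsupp.linearCombination 𝕜 fun t => Finsupp.single (t.1 + 1, t.2.1, t.2.2) 1

/-- The action of `z` in the representation on the space with basis `uⁱ zʲ vˡ`. -/
noncomputable def opZ : Module.End 𝕜 (ℕ × ℕ × ℕ →₀ 𝕜) :=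
  Finsupp.linearCombination 𝕜 fun t => r ^ t.1 • Finsupp.single (t.1, t.2.1 + 1, t.2.2) 1

/-- The action of `v` in the representation on the space with basis `uⁱ zʲ vˡ`. -/
noncomputable def opV : Module.End 𝕜 (ℕ × ℕ × ℕ →₀ 𝕜) :=
  Finsupp.linearCombination 𝕜 fun t =>
    (p ^ t.1 * r ^ t.2.1) • Finsupp.single (t.1, t.2.1, t.2.2 + 1) 1 +
      mixedSum p r t.1 • Finsupp.single (t.1 - 1, t.2.1 + 1, t.2.2) 1

variable (i j l : ℕ)

theorem opU_single : opU (Finsupp.single (i, j, l) (1 : 𝕜)) = Finsupp.single (i + 1, j, l) 1 := by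
  simp [opU]

theorem opZ_single : opZ r (Finsupp.single (i, j, l) (1 : 𝕜)) =
    r ^ i • Finsupp.single (i, j + 1, l) 1 := by
  simp [opZ]

theorem opV_single : opV p r (Finsupp.single (i, j, l) (1 : 𝕜)) =
    (p ^ i * r ^ j) • Finsupp.single (i, j, l + 1) 1 +
      mixedSum p r i • Finsupp.single (i - 1, j + 1, l) 1 := by
  rw [opV, Finsupp.linearCombination_single, one_smul]

theorem end_ext {f g : Module.End 𝕜 (ℕ × ℕ × ℕ →₀ 𝕜)}
    (h : ∀ i j l, f (Finsupp.single (i, j, l) 1) = g (Finsupp.single (i, j, l) 1)) : f = g :=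
  Finsupp.lhom_ext' fun t => LinearMap.ext_ring (h t.1 t.2.1 t.2.2)

theorem opV_mul_opU : opV p r * opU = p • (opU * opV p r) + opZ r := by
  refine end_ext fun i j l => ?_
  simp only [Module.End.mul_apply, LinearMap.add_apply, LinearMap.smul_apply, opU_single,
    opV_single, opZ_single, map_add, map_smul]
  rw [mixedSum_succ' p r i]
  rcases i with _ | i
  · simp [mixedSum]
  · simp only [Nat.add_sub_cancel]
    module

theorem opV_mul_opZ : opV p r * opZ r = r • (opZ r * opV p r) := by
  refine end_ext fun i j l => ?_
  simp only [Module.End.mul_apply, LinearMap.smul_apply, opV_single, opZ_single, map_add,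
    map_smul]
  rcases i with _ | i
  · simp [mixedSum, pow_succ, mul_comm]
  · simp only [Nat.add_sub_cancel]
    module

theorem opZ_mul_opU : opZ r * opU = r • (opU * opZ r) := by
  refine end_ext fun i j l => ?_
  simp only [Module.End.mul_apply, LinearMap.smul_apply, opU_single, opZ_single,
    map_smul, smul_smul, pow_succ']

variable {p r} {α β : 𝕜} (hα : α = p + r) (hβ : β = -(p * r))

/-- The representation of the down-up algebra that the basis `uⁱ zʲ vˡ` would give. -/
noncomputable def rep : DownUp α β →ₐ[𝕜] Module.End 𝕜 (ℕ × ℕ × ℕ →₀ 𝕜) :=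
  lift opU (opV p r)
    (v_v_u_of_normal (opV_mul_opU p r) (opV_mul_opZ p r) hα hβ)
    (v_u_u_of_normal (opV_mul_opU p r) (opZ_mul_opU r) hα hβ)

theorem rep_u : rep hα hβ (u α β) = opU := lift_u ..

theorem rep_v : rep hα hβ (v α β) = opV p r := lift_v ..

theorem rep_z : rep hα hβ (z α β p) = opZ r := by
  rw [z, map_sub, map_smul, map_mul, map_mul, rep_u, rep_v, opV_mul_opU]
  abel

theorem rep_monomial (t : ℕ × ℕ × ℕ) :
    rep hα hβ (monomial₃ (u α β) (z α β p) (v α β) t) (Finsupp.single (0, 0, 0) 1) =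
      Finsupp.single t 1 := by
  have hv : ∀ l, (opV p r ^ l) (Finsupp.single (0, 0, 0) (1 : 𝕜)) =
      Finsupp.single (0, 0, l) 1 := by
    intro l
    induction l with
    | zero => simp
    | succ l ih => rw [pow_succ', Module.End.mul_apply, ih, opV_single]; simp [mixedSum]
  have hz : ∀ j l, (opZ r ^ j) (Finsupp.single (0, 0, l) (1 : 𝕜)) =
      Finsupp.single (0, j, l) 1 := by
    intro j l
    induction j with
    | zero => simp
    | succ j ih => rw [pow_succ', Module.End.mul_apply, ih, opZ_single]; simp
  have hu : ∀ i j l, (opU ^ i) (Finsupp.single (0, j, l) (1 : 𝕜)) =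
      Finsupp.single (i, j, l) 1 := by
    intro i j l
    induction i with
    | zero => simp
    | succ i ih => rw [pow_succ', Module.End.mul_apply, ih, opU_single]
  rw [monomial₃, map_mul, map_mul, map_pow, map_pow, map_pow, rep_u, rep_v, rep_z,
    Module.End.mul_apply, Module.End.mul_apply, hv, hz, hu]

theorem linearIndependent_monomials (hα : α = p + r) (hβ : β = -(p * r)) :
    LinearIndependent 𝕜 (monomial₃ (u α β) (z α β p) (v α β)) := by
  refine LinearIndependent.of_comp
    (LinearMap.applyₗ (Finsupp.single (0, 0, 0) (1 : 𝕜)) ∘ₗ (rep hα hβ).toLinearMap) ?_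
  have : (LinearMap.applyₗ (Finsupp.single (0, 0, 0) (1 : 𝕜)) ∘ₗ (rep hα hβ).toLinearMap) ∘
      monomial₃ (u α β) (z α β p) (v α β) = fun t => Finsupp.single t (1 : 𝕜) :=
    funext fun t => rep_monomial hα hβ t
  rw [this]
  exact Finsupp.linearIndependent_single_one 𝕜 _

end Representation

end DownUp

end DownUpBasis

section DownUpGrading

variable {𝕜 : Type u} [Field 𝕜]

namespace DownUp

variable {p r α β : 𝕜}

/-- The weight of the monomial `uⁱ zʲ vˡ`. -/
def weight (t : ℕ × ℕ × ℕ) : ℕ := t.1 + 2 * t.2.1 + t.2.2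

theorem generator_mul_mem (hα : α = p + r) (hβ : β = -(p * r)) (d : ℕ) (g : DownUp α β)
    (hg : g = u α β ∨ g = v α β) {s : DownUp α β}
    (hs : s ∈ Submodule.span 𝕜 (monomial₃ (u α β) (z α β p) (v α β) '' {t | weight t = d})) :
    g * s ∈ Submodule.span 𝕜
      (monomial₃ (u α β) (z α β p) (v α β) '' {t | weight t = d + 1}) := by
  induction hs using Submodule.span_induction with
  | mem s hs =>
    obtain ⟨⟨i, j, l⟩, ht, rfl⟩ := hs
    have ht : i + 2 * j + l = d := ht
    rcases hg with rfl | rfl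
    · refine Submodule.subset_span ⟨(i + 1, j, l), ?_, ?_⟩
      · simp only [weight, Set.mem_ofPred_eq]
        omega
      · simp [monomial₃, pow_succ', mul_assoc]
    · rw [v_mul_monomial hα hβ]
      refine add_mem (Submodule.smul_mem _ _ (Submodule.subset_span ⟨_, ?_, rfl⟩)) ?_
      · simp only [weight, Set.mem_ofPred_eq]
        omega
      · rcases i with _ | i
        · simp [mixedSum]
        · refine Submodule.smul_mem _ _ (Submodule.subset_span ⟨_, ?_, rfl⟩)
          simp only [weight, Set.mem_ofPred_eq]
          omega
  | zero => rw [mul_zero]; exact Submodule.zero_mem _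
  | add s t _ _ hs ht => rw [mul_add]; exact add_mem hs ht
  | smul c s _ hs => rw [mul_smul_comm]; exact Submodule.smul_mem _ _ hs

theorem grading_eq_span (hα : α = p + r) (hβ : β = -(p * r)) (d : ℕ) : grading α β d =
    Submodule.span 𝕜 (monomial₃ (u α β) (z α β p) (v α β) '' {t | weight t = d}) := by
  apply le_antisymm
  · rw [grading]
    induction d with
    | zero =>
      rw [pow_zero, Submodule.one_le]
      exact Submodule.subset_span ⟨(0, 0, 0), by simp [weight], by simp [monomial₃]⟩
    | succ d ih =>
      rw [pow_succ', Submodule.mul_le]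
      intro g hg s hs
      induction hg using Submodule.span_induction with
      | mem g hg => exact generator_mul_mem hα hβ d g hg (ih hs)
      | zero => rw [zero_mul]; exact Submodule.zero_mem _
      | add g g' _ _ hg hg' => rw [add_mul]; exact add_mem hg hg'
      | smul c g _ hg => rw [smul_mul_assoc]; exact Submodule.smul_mem _ _ hg
  · rw [Submodule.span_le]
    rintro _ ⟨⟨i, j, l⟩, ht, rfl⟩
    have ht : i + 2 * j + l = d := ht
    rw [← ht, SetLike.mem_coe, grading, pow_add, pow_add, pow_mul]
    have hu : u α β ∈ Submodule.span 𝕜 {u α β, v α β} := Submodule.subset_span (by simp)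
    have hv : v α β ∈ Submodule.span 𝕜 {u α β, v α β} := Submodule.subset_span (by simp)
    have hz : z α β p ∈ (Submodule.span 𝕜 {u α β, v α β}) ^ 2 := by
      rw [pow_two]
      exact sub_mem (Submodule.mul_mem_mul hv hu)
        (Submodule.smul_mem _ _ (Submodule.mul_mem_mul hu hv))
    exact Submodule.mul_mem_mul (Submodule.mul_mem_mul (Submodule.pow_mem_pow _ hu i)
      (Submodule.pow_mem_pow _ hz j)) (Submodule.pow_mem_pow _ hv l)

theorem span_monomials (hα : α = p + r) (hβ : β = -(p * r)) :
    ⊤ ≤ Submodule.span 𝕜 (Set.range (monomial₃ (u α β) (z α β p) (v α β))) := by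
  intro a _
  set S := Submodule.span 𝕜 (Set.range (monomial₃ (u α β) (z α β p) (v α β)))
  refine mem_of_left_stable (RingQuot.mkAlgHom 𝕜 (DownUpRel α β))
    (RingQuot.mkAlgHom_surjective _ _) S (Submodule.subset_span ⟨(0, 0, 0), by simp [monomial₃]⟩)
    ?_ a
  intro g s hs
  induction hs using Submodule.span_induction with
  | mem s hs =>
    obtain ⟨t, rfl⟩ := hs
    refine Submodule.span_mono (Set.image_subset_range _ _) (generator_mul_mem hα hβ (weight t) _ ?_
      (Submodule.subset_span ⟨t, rfl, rfl⟩))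
    cases g
    · exact Or.inl rfl
    · exact Or.inr rfl
  | zero => rw [mul_zero]; exact Submodule.zero_mem _
  | add s t _ _ hs ht => rw [mul_add]; exact add_mem hs ht
  | smul c s _ hs => rw [mul_smul_comm]; exact Submodule.smul_mem _ _ hs

/-- The Poincaré–Birkhoff–Witt basis `uⁱ zʲ vˡ`. -/
noncomputable def basis (hα : α = p + r) (hβ : β = -(p * r)) :
    Module.Basis (ℕ × ℕ × ℕ) 𝕜 (DownUp α β) :=
  Module.Basis.mk (linearIndependent_monomials hα hβ) (span_monomials hα hβ)

theorem basis_apply (hα : α = p + r) (hβ : β = -(p * r)) (t : ℕ × ℕ × ℕ) :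
    basis hα hβ t = monomial₃ (u α β) (z α β p) (v α β) t := by simp [basis]

theorem coe_basis (hα : α = p + r) (hβ : β = -(p * r)) :
    ⇑(basis hα hβ) = monomial₃ (u α β) (z α β p) (v α β) := funext (basis_apply hα hβ)

end DownUp

end DownUpGrading

/-! ### Taft algebra actions and the coefficients of `x · vˡ` -/

section Invariants

variable {𝕜 : Type u} [Field 𝕜] {n : ℕ} {ω : 𝕜} {hn : 2 ≤ n} {hω : IsPrimitiveRoot ω n}

namespace Taft

variable {A : Type w} [Ring A] [Algebra 𝕜 A] (T : HopfAction 𝕜 (Taft hn hω) A)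

theorem act_g_mul (a b : A) : T.act (g hn hω) (a * b) =
    T.act (g hn hω) a * T.act (g hn hω) b := by
  have h : Coalgebra.comul (R := 𝕜) (g hn hω) = g hn hω ⊗ₜ[𝕜] g hn hω := comulHom_g hn hω
  rw [T.act_mul, h]
  simp

theorem act_g_one : T.act (g hn hω) 1 = 1 := by
  have h : Coalgebra.counit (R := 𝕜) (g hn hω) = 1 := counitHom_g hn hω
  rw [T.act_one, h, one_smul]

theorem act_g_pow {a : A} {c : 𝕜} (h : T.act (g hn hω) a = c • a) (i : ℕ) :
    T.act (g hn hω) (a ^ i) = c ^ i • a ^ i := by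
  induction i with
  | zero => rw [pow_zero, pow_zero, one_smul, act_g_one]
  | succ i ih => rw [pow_succ, act_g_mul, ih, h, smul_mul_smul_comm, ← pow_succ, ← pow_succ]

end Taft

/-- The coefficients of `u vˡ⁻¹` in `x · vˡ`, up to the factor `q`: the sums `∑ ω⁻ⁱ` over
`i < l`. -/
def uCoeff (ω : 𝕜) : ℕ → 𝕜
  | 0 => 0
  | l + 1 => 1 + ω⁻¹ * uCoeff ω l

/-- The coefficients of `z vˡ⁻²` in `x · vˡ`, up to the factor `q`, for `κ = ω ^ k`. The recursion
comes from `x · vˡ⁺¹ = (g · v) (x · vˡ) + (x · v) vˡ`, by moving `v` past `u` and `z`. -/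
def zCoeff (ω s κ : 𝕜) : ℕ → 𝕜
  | 0 => 0
  | l + 1 => κ * uCoeff ω l + s⁻¹ * zCoeff ω s κ l

theorem uCoeff_mul (l : ℕ) : uCoeff ω l * (1 - ω⁻¹) = 1 - ω⁻¹ ^ l := by
  induction l with
  | zero => simp [uCoeff]
  | succ l ih =>
    rw [uCoeff]
    linear_combination ω⁻¹ * ih

/-- The closed form of `zCoeff`. The factor `s⁻ˡ - 1` shows that it vanishes together with
`uCoeff` when `n` divides `l`; this is where the order of `s` is needed. -/
theorem zCoeff_mul {s κ : 𝕜} (hs : s ^ 2 = ω) (l : ℕ) :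
    zCoeff ω s κ l * ((1 - s⁻¹) * (1 - ω⁻¹) * s⁻¹) = κ * ((s⁻¹ ^ l - 1) * (s⁻¹ ^ l - s⁻¹)) := by
  have hω' : ω⁻¹ = s⁻¹ ^ 2 := by rw [← hs, inv_pow]
  induction l with
  | zero => simp [zCoeff]
  | succ l ih =>
    have h := uCoeff_mul (ω := ω) l
    rw [hω', ← pow_mul, mul_comm 2 l, pow_mul] at h
    rw [hω'] at ih ⊢
    rw [zCoeff]
    linear_combination s⁻¹ * ih + κ * (1 - s⁻¹) * s⁻¹ * h

theorem uCoeff_ne_zero (hω : IsPrimitiveRoot ω n) {l : ℕ} (hl : ¬ n ∣ l) : uCoeff ω l ≠ 0 := by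
  intro h
  have := uCoeff_mul (ω := ω) l
  rw [h, zero_mul] at this
  exact hl (hω.inv.dvd_of_pow_eq_one l (sub_eq_zero.mp this.symm).symm)

theorem zCoeff_eq_zero (hn : 2 ≤ n) (hω : IsPrimitiveRoot ω n) {s κ : 𝕜} (hs : s ^ 2 = ω)
    (hsn : s ^ n = 1) {l : ℕ} (hl : n ∣ l) : zCoeff ω s κ l = 0 := by
  have hω1 : ω ≠ 1 := hω.ne_one hn
  have hω0 : ω ≠ 0 := hω.ne_zero (by omega)
  have hs0 : s ≠ 0 := by rintro rfl; exact hω0 (by rw [← hs]; simp)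
  have hs1 : s ≠ 1 := by rintro rfl; exact hω1 (by rw [← hs]; simp)
  have hpow : s⁻¹ ^ l = 1 := by
    obtain ⟨m, rfl⟩ := hl
    rw [inv_pow, pow_mul, hsn, one_pow, inv_one]
  have := zCoeff_mul (κ := κ) hs l
  rw [hpow, sub_self, zero_mul, mul_zero] at this
  refine (mul_eq_zero.mp this).resolve_right (mul_ne_zero (mul_ne_zero ?_ ?_) (inv_ne_zero hs0))
  · rw [sub_ne_zero]; exact fun h => hs1 (inv_eq_one.mp h.symm)
  · rw [sub_ne_zero]; exact fun h => hω1 (inv_eq_one.mp h.symm)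

theorem uCoeff_eq_zero (hn : 2 ≤ n) (hω : IsPrimitiveRoot ω n) {l : ℕ} (hl : n ∣ l) :
    uCoeff ω l = 0 := by
  have := uCoeff_mul (ω := ω) l
  rw [inv_pow, (hω.pow_eq_one_iff_dvd l).mpr hl, inv_one, sub_self] at this
  refine (mul_eq_zero.mp this).resolve_right ?_
  rw [sub_eq_zero]; exact fun h => hω.ne_one hn (inv_eq_one.mp h.symm)

end Invariants

/-! ### The invariants of the Taft algebra in the down-up algebra -/

section TaftOnDownUp

variable {𝕜 : Type u} [Field 𝕜] {n : ℕ} {ω : 𝕜} {hn : 2 ≤ n} {hω : IsPrimitiveRoot ω n}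

open DownUp

/-- The action of the Taft algebra on the down-up algebra with roots `p = ω^{-(k+1)}` and
`r = p s`, where `s² = ω`: the generator `g` acts diagonally, and `x` maps `u` to `0` and `v`
to `q u`. -/
structure IsDownUpAction {α β : 𝕜} (T : HopfAction 𝕜 (Taft hn hω) (DownUp α β)) (k : ℕ)
    (s p r q : 𝕜) : Prop where
  s_sq : s ^ 2 = ω
  s_pow : s ^ n = 1
  q_ne_zero : q ≠ 0
  p_mul : p * ω ^ (k + 1) = 1
  r_eq : r = p * s
  α_eq : α = p + r
  β_eq : β = -(p * r)
  g_u : T.act (Taft.g hn hω) (u α β) = ω ^ (k + 1) • u α β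
  g_v : T.act (Taft.g hn hω) (v α β) = ω ^ k • v α β
  x_u : T.act (Taft.x hn hω) (u α β) = 0
  x_v : T.act (Taft.x hn hω) (v α β) = q • u α β

namespace IsDownUpAction

variable {α β : 𝕜} {T : HopfAction 𝕜 (Taft hn hω) (DownUp α β)} {k : ℕ} {s p r q : 𝕜}

theorem ω_ne_zero (H : IsDownUpAction T k s p r q) : ω ≠ 0 := by
  rintro rfl
  simpa using H.p_mul

theorem s_ne_zero (H : IsDownUpAction T k s p r q) : s ≠ 0 := by
  rintro rfl
  exact H.ω_ne_zero (by rw [← H.s_sq]; simp)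

theorem p_ne_zero (H : IsDownUpAction T k s p r q) : p ≠ 0 := left_ne_zero_of_mul_eq_one H.p_mul

theorem r_ne_zero (H : IsDownUpAction T k s p r q) : r ≠ 0 := by
  rw [H.r_eq]; exact mul_ne_zero H.p_ne_zero H.s_ne_zero

theorem p_pow (H : IsDownUpAction T k s p r q) (hω : IsPrimitiveRoot ω n) : p ^ n = 1 := by
  have h : (p * ω ^ (k + 1)) ^ n = 1 := by rw [H.p_mul, one_pow]
  rwa [mul_pow, ← pow_mul, mul_comm (k + 1), pow_mul, hω.pow_eq_one, one_pow, mul_one] at h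

theorem r_pow (H : IsDownUpAction T k s p r q) (hω : IsPrimitiveRoot ω n) : r ^ n = 1 := by
  rw [H.r_eq, mul_pow, H.p_pow hω, H.s_pow, one_mul]

theorem ωk_mul_p (H : IsDownUpAction T k s p r q) : ω ^ k * p = ω⁻¹ := by
  refine eq_inv_of_mul_eq_one_left ?_
  rw [← H.p_mul]
  ring

theorem ωk_mul_r (H : IsDownUpAction T k s p r q) : ω ^ k * r = s⁻¹ := by
  rw [H.r_eq, ← mul_assoc, H.ωk_mul_p, ← H.s_sq]
  field_simp [H.s_ne_zero]

theorem g_z (H : IsDownUpAction T k s p r q) :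
    T.act (Taft.g hn hω) (z α β p) = (ω ^ k * ω ^ (k + 1)) • z α β p := by
  rw [z, map_sub, map_smul, Taft.act_g_mul, Taft.act_g_mul, H.g_u, H.g_v, smul_mul_smul_comm,
    smul_mul_smul_comm]
  module

theorem x_z (H : IsDownUpAction T k s p r q) : T.act (Taft.x hn hω) (z α β p) = 0 := by
  rw [z, map_sub, map_smul, Taft.act_x_mul, Taft.act_x_mul, H.g_u, H.g_v, H.x_u, H.x_v, mul_zero,
    zero_mul, zero_add, add_zero, smul_mul_smul_comm, smul_mul_assoc, smul_smul, ← mul_assoc,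
    H.p_mul, one_mul, sub_self]

theorem u_mem (H : IsDownUpAction T k s p r q) : u α β ∈ Taft.xInvariants T := H.x_u

theorem z_mem (H : IsDownUpAction T k s p r q) : z α β p ∈ Taft.xInvariants T := H.x_z

/-- For `l = 0` the truncated exponent `l - 1` is harmless, since then the coefficient of the
second term is zero. -/
theorem x_v_pow (H : IsDownUpAction T k s p r q) (l : ℕ) :
    T.act (Taft.x hn hω) (v α β ^ (l + 1)) =
      q • (uCoeff ω (l + 1) • (u α β * v α β ^ l) +
        zCoeff ω s (ω ^ k) (l + 1) • (z α β p * v α β ^ (l - 1))) := by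
  induction l with
  | zero => simp [uCoeff, zCoeff, H.x_v]
  | succ l ih =>
    rw [pow_succ' _ (l + 1), Taft.act_x_mul, ih, H.g_v, H.x_v]
    have h1 : v α β * (u α β * v α β ^ l) =
        p • (u α β * v α β ^ (l + 1)) + z α β p * v α β ^ l := by
      rw [← mul_assoc, v_mul_u (p := p), add_mul, smul_mul_assoc, mul_assoc, ← pow_succ']
    have h2 : zCoeff ω s (ω ^ k) (l + 1) • (v α β * (z α β p * v α β ^ (l - 1))) =
        (zCoeff ω s (ω ^ k) (l + 1) * r) • (z α β p * v α β ^ l) := by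
      rcases l with _ | l
      · simp [zCoeff, uCoeff]
      · rw [← mul_assoc, v_mul_z H.α_eq H.β_eq, smul_mul_assoc, smul_smul, mul_assoc,
          Nat.add_sub_cancel, ← pow_succ']
    rw [mul_smul_comm, mul_add, mul_smul_comm, smul_mul_assoc, smul_mul_assoc, h1,
      mul_smul_comm, h2, show uCoeff ω (l + 1 + 1) = 1 + ω⁻¹ * uCoeff ω (l + 1) from rfl,
      show zCoeff ω s (ω ^ k) (l + 1 + 1) = ω ^ k * uCoeff ω (l + 1) +
        s⁻¹ * zCoeff ω s (ω ^ k) (l + 1) from rfl, ← H.ωk_mul_p, ← H.ωk_mul_r, Nat.add_sub_cancel,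
      smul_mul_assoc]
    module

/-- The scalar `ω^{(k + 1) i + (2 k + 1) j}` by which `g` acts on `uⁱ zʲ`. -/
def character (ω : 𝕜) (k i j : ℕ) : 𝕜 := (ω ^ (k + 1)) ^ i * (ω ^ k * ω ^ (k + 1)) ^ j

theorem character_ne_zero (hω : ω ≠ 0) (i j : ℕ) : character ω k i j ≠ 0 :=
  mul_ne_zero (pow_ne_zero _ (pow_ne_zero _ hω))
    (pow_ne_zero _ (mul_ne_zero (pow_ne_zero _ hω) (pow_ne_zero _ hω)))

/-- The action of `x` on the basis. The exponents `l - 1` and `l - 2` are truncated only where the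
coefficients vanish. -/
theorem x_monomial (H : IsDownUpAction T k s p r q) (i j l : ℕ) :
    T.act (Taft.x hn hω) (monomial₃ (u α β) (z α β p) (v α β) (i, j, l)) =
      (character ω k i j * q * uCoeff ω l * r ^ j) •
        monomial₃ (u α β) (z α β p) (v α β) (i + 1, j, l - 1) +
      (character ω k i j * q * zCoeff ω s (ω ^ k) l) •
        monomial₃ (u α β) (z α β p) (v α β) (i, j + 1, l - 2) := by
  have hx : T.act (Taft.x hn hω) (u α β ^ i * z α β p ^ j) = 0 :=
    mul_mem (pow_mem H.u_mem i) (pow_mem H.z_mem j)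
  have hg : T.act (Taft.g hn hω) (u α β ^ i * z α β p ^ j) =
      character ω k i j • (u α β ^ i * z α β p ^ j) := by
    rw [Taft.act_g_mul, Taft.act_g_pow T H.g_u, Taft.act_g_pow T H.g_z, smul_mul_smul_comm]
    rfl
  rcases l with _ | l
  · simp [monomial₃, uCoeff, zCoeff, hx]
  · simp only [monomial₃]
    rw [Taft.act_x_mul, hx, zero_mul, add_zero, hg, H.x_v_pow, Nat.add_sub_cancel,
      show l + 1 - 2 = l - 1 by omega]
    have h1 : u α β ^ i * z α β p ^ j * (u α β * v α β ^ l) =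
        r ^ j • (u α β ^ (i + 1) * z α β p ^ j * v α β ^ l) := by
      rw [← mul_assoc, mul_assoc (u α β ^ i), z_pow_mul_u H.α_eq H.β_eq]
      simp only [mul_smul_comm, smul_mul_assoc, pow_succ, mul_assoc]
    have h2 : u α β ^ i * z α β p ^ j * (z α β p * v α β ^ (l - 1)) =
        u α β ^ i * z α β p ^ (j + 1) * v α β ^ (l - 1) := by
      simp only [pow_succ, mul_assoc]
    rw [smul_mul_assoc, mul_smul_comm, mul_add, mul_smul_comm, mul_smul_comm, h1, h2]
    module

/-- The PBW basis, for the parameters of the action. -/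
noncomputable def pbw (H : IsDownUpAction T k s p r q) :
    Module.Basis (ℕ × ℕ × ℕ) 𝕜 (DownUp α β) := DownUp.basis H.α_eq H.β_eq

theorem pbw_apply (H : IsDownUpAction T k s p r q) (t : ℕ × ℕ × ℕ) :
    H.pbw t = monomial₃ (u α β) (z α β p) (v α β) t := DownUp.basis_apply _ _ _

theorem coord_monomial (H : IsDownUpAction T k s p r q) (t t' : ℕ × ℕ × ℕ) :
    H.pbw.coord t (monomial₃ (u α β) (z α β p) (v α β) t') = if t' = t then 1 else 0 := by
  rw [← H.pbw_apply, Module.Basis.coord_apply, Module.Basis.repr_self,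
    Finsupp.single_apply]

theorem coord_x_zero (H : IsDownUpAction T k s p r q) (i l : ℕ) (a : DownUp α β) :
    H.pbw.coord (i + 1, 0, l) (T.act (Taft.x hn hω) a) =
      character ω k i 0 * q * uCoeff ω (l + 1) * H.pbw.coord (i, 0, l + 1) a := by
  have : H.pbw.coord (i + 1, 0, l) ∘ₗ T.act (Taft.x hn hω) =
      (character ω k i 0 * q * uCoeff ω (l + 1)) • H.pbw.coord (i, 0, l + 1) := by
    refine H.pbw.ext fun t => ?_
    obtain ⟨i', j', l'⟩ := t
    rw [H.pbw_apply, LinearMap.comp_apply, H.x_monomial, map_add, map_smul,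
      map_smul, LinearMap.smul_apply, H.coord_monomial, H.coord_monomial, H.coord_monomial]
    rcases l' with _ | l'
    · simp [uCoeff]
    · simp only [Prod.mk.injEq, Nat.add_right_cancel_iff, Nat.add_sub_cancel, Nat.add_one_ne_zero,
        false_and, and_false, if_false, smul_zero, add_zero]
      split_ifs with h
      · obtain ⟨rfl, rfl, rfl⟩ := h
        simp
      · simp
  exact congrArg (fun f => f a) this

theorem coord_x_succ (H : IsDownUpAction T k s p r q) (i j l : ℕ) (a : DownUp α β) :
    H.pbw.coord (i + 1, j + 1, l) (T.act (Taft.x hn hω) a) =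
      character ω k i (j + 1) * q * uCoeff ω (l + 1) * r ^ (j + 1) *
        H.pbw.coord (i, j + 1, l + 1) a +
      character ω k (i + 1) j * q * zCoeff ω s (ω ^ k) (l + 2) *
        H.pbw.coord (i + 1, j, l + 2) a := by
  have : H.pbw.coord (i + 1, j + 1, l) ∘ₗ T.act (Taft.x hn hω) =
      (character ω k i (j + 1) * q * uCoeff ω (l + 1) * r ^ (j + 1)) •
        H.pbw.coord (i, j + 1, l + 1) +
      (character ω k (i + 1) j * q * zCoeff ω s (ω ^ k) (l + 2)) •
        H.pbw.coord (i + 1, j, l + 2) := by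
    refine H.pbw.ext fun t => ?_
    obtain ⟨i', j', l'⟩ := t
    rw [H.pbw_apply, LinearMap.comp_apply, H.x_monomial, map_add, map_smul,
      map_smul, LinearMap.add_apply, LinearMap.smul_apply, LinearMap.smul_apply, H.coord_monomial,
      H.coord_monomial, H.coord_monomial, H.coord_monomial]
    congr 1
    · rcases l' with _ | l'
      · simp [uCoeff]
      · simp only [Prod.mk.injEq, Nat.add_right_cancel_iff, Nat.add_sub_cancel]
        split_ifs with h
        · obtain ⟨rfl, rfl, rfl⟩ := h
          rfl
        · simp
    · rcases l' with _ | _ | l'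
      · simp [zCoeff]
      · simp [zCoeff, uCoeff]
      · simp only [Prod.mk.injEq, Nat.add_right_cancel_iff,
          show l' + 1 + 1 - 2 = l' by omega, show l' + 1 + 1 = l + 2 ↔ l' = l by omega]
        split_ifs with h
        · obtain ⟨rfl, rfl, rfl⟩ := h
          rfl
        · simp
  exact congrArg (fun f => f a) this

/-- In an invariant element, only the powers of `vⁿ` occur. The proof is by induction on the
exponent of `z`: the coefficient of `uⁱ⁺¹ zʲ vˡ⁻¹` in `x · a` is a nonzero multiple of the
coefficient of `uⁱ zʲ vˡ` in `a`, up to a multiple of the coefficient of `uⁱ⁺¹ zʲ⁻¹ vˡ⁺¹`. -/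
theorem coord_eq_zero (H : IsDownUpAction T k s p r q) {a : DownUp α β}
    (ha : T.act (Taft.x hn hω) a = 0) {i j l : ℕ} (hl : ¬ n ∣ l) :
    H.pbw.coord (i, j, l) a = 0 := by
  induction j generalizing i l with
  | zero =>
    obtain ⟨l, rfl⟩ : ∃ l', l = l' + 1 := ⟨l - 1, by
      rcases l with _ | l
      · exact absurd (dvd_zero n) hl
      · rfl⟩
    have h := H.coord_x_zero i l a
    rw [ha, map_zero] at h
    exact (mul_eq_zero.mp h.symm).resolve_left (mul_ne_zero (mul_ne_zero
      (character_ne_zero H.ω_ne_zero _ _) H.q_ne_zero) (uCoeff_ne_zero hω hl))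
  | succ j ih =>
    obtain ⟨l, rfl⟩ : ∃ l', l = l' + 1 := ⟨l - 1, by
      rcases l with _ | l
      · exact absurd (dvd_zero n) hl
      · rfl⟩
    have h := H.coord_x_succ i j l a
    have h2 : zCoeff ω s (ω ^ k) (l + 2) * H.pbw.coord (i + 1, j, l + 2) a = 0 := by
      by_cases hd : n ∣ l + 2
      · rw [zCoeff_eq_zero hn hω H.s_sq H.s_pow hd, zero_mul]
      · rw [ih hd, mul_zero]
    rw [ha, map_zero, mul_assoc _ (zCoeff ω s (ω ^ k) (l + 2)), h2, mul_zero, add_zero] at h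
    exact (mul_eq_zero.mp h.symm).resolve_left (mul_ne_zero (mul_ne_zero (mul_ne_zero
      (character_ne_zero H.ω_ne_zero _ _) H.q_ne_zero) (uCoeff_ne_zero hω hl))
      (pow_ne_zero _ H.r_ne_zero))

/-- At `l = n` both coefficients of `x · vˡ` vanish. -/
theorem v_pow_mem (H : IsDownUpAction T k s p r q) : v α β ^ n ∈ Taft.xInvariants T := by
  have h := H.x_monomial 0 0 n
  rw [uCoeff_eq_zero hn hω dvd_rfl, zCoeff_eq_zero hn hω H.s_sq H.s_pow dvd_rfl] at h
  change T.act (Taft.x hn hω) (v α β ^ n) = 0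
  simpa [monomial₃] using h

theorem v_pow_mul_u (H : IsDownUpAction T k s p r q) :
    v α β ^ n * u α β = u α β * v α β ^ n := by
  have hs1 : s ≠ 1 := by
    rintro rfl
    exact hω.ne_one hn (by rw [← H.s_sq, one_pow])
  -- `p` and `r` are distinct `n`-th roots of unity, so `∑ pᵃ rᵇ = (pⁿ - rⁿ) / (p - r) = 0`.
  have hsum : mixedSum p r n = 0 := by
    have h := sub_mul_mixedSum p r n
    rw [H.p_pow hω, H.r_pow hω, sub_self] at h
    refine (mul_eq_zero.mp h).resolve_left ?_
    rw [H.r_eq, sub_eq_zero]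
    exact fun h => hs1 (mul_left_cancel₀ H.p_ne_zero (by rw [← h, mul_one]))
  obtain ⟨m, rfl⟩ : ∃ m, n = m + 1 := ⟨n - 1, by omega⟩
  rw [DownUp.v_pow_mul_u H.α_eq H.β_eq, H.p_pow hω, hsum, one_smul, zero_smul, add_zero]

theorem v_pow_mul_z (H : IsDownUpAction T k s p r q) :
    v α β ^ n * z α β p = z α β p * v α β ^ n := by
  have key : ∀ m, v α β ^ m * z α β p = r ^ m • (z α β p * v α β ^ m) := by
    intro m
    induction m with
    | zero => simp
    | succ m ih =>
      rw [pow_succ', mul_assoc, ih, mul_smul_comm, ← mul_assoc, v_mul_z H.α_eq H.β_eq,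
        smul_mul_assoc, smul_smul, mul_assoc, ← pow_succ]
  rw [key, H.r_pow hω, one_smul]

/-- The exponents of `u`, `z`, `vⁿ` rewritten as exponents of `u`, `z`, `v`. -/
def stretch (n : ℕ) (t : ℕ × ℕ × ℕ) : ℕ × ℕ × ℕ := (t.1, t.2.1, n * t.2.2)

theorem stretch_injective (hn : 0 < n) : Function.Injective (stretch n) := by
  rintro ⟨i, j, l⟩ ⟨i', j', l'⟩ h
  simp only [stretch, Prod.mk.injEq] at h ⊢
  exact ⟨h.1, h.2.1, Nat.eq_of_mul_eq_mul_left hn h.2.2⟩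

/-- The monomials in the invariants `u`, `z`, `vⁿ`. -/
def invariantMonomial (H : IsDownUpAction T k s p r q) (t : ℕ × ℕ × ℕ) : Taft.xInvariants T :=
  monomial₃ ⟨u α β, H.u_mem⟩ ⟨z α β p, H.z_mem⟩ ⟨v α β ^ n, H.v_pow_mem⟩ t

theorem coe_invariantMonomial (H : IsDownUpAction T k s p r q) (t : ℕ × ℕ × ℕ) :
    (H.invariantMonomial t : DownUp α β) =
      monomial₃ (u α β) (z α β p) (v α β) (stretch n t) := by
  have := map_monomial₃ (A := Taft.xInvariants T) (B := DownUp α β) (Taft.xInvariants T).val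
    ⟨u α β, H.u_mem⟩ ⟨z α β p, H.z_mem⟩ ⟨v α β ^ n, H.v_pow_mem⟩ t
  exact this.trans (by simp [monomial₃, stretch, pow_mul])

/-- Membership in the span of some of the invariant monomials can be read off from the coordinates
in the basis of the down-up algebra. -/
theorem mem_span_invariantMonomial_iff (H : IsDownUpAction T k s p r q) (S : Set (ℕ × ℕ × ℕ))
    (b : Taft.xInvariants T) : b ∈ Submodule.span 𝕜 (H.invariantMonomial '' S) ↔
      ((H.pbw.repr (b : DownUp α β)).support : Set (ℕ × ℕ × ℕ)) ⊆ stretch n '' S := by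
  rw [← Module.Basis.mem_span_image, pbw, DownUp.coe_basis, ← Set.image_comp]
  have hmap : Submodule.span 𝕜 (monomial₃ (u α β) (z α β p) (v α β) ∘ stretch n '' S) =
      (Submodule.span 𝕜 (H.invariantMonomial '' S)).map (Taft.xInvariants T).val.toLinearMap := by
    rw [Submodule.map_span, ← Set.image_comp]
    congr 2
    exact funext fun t => (H.coe_invariantMonomial t).symm
  rw [hmap]
  constructor
  · exact fun h => ⟨b, h, rfl⟩
  · rintro ⟨b', hb', h⟩
    exact (Subtype.ext h : b' = b) ▸ hb'

theorem support_subset (H : IsDownUpAction T k s p r q) (b : Taft.xInvariants T) :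
    ((H.pbw.repr (b : DownUp α β)).support : Set (ℕ × ℕ × ℕ)) ⊆ Set.range (stretch n) := by
  rintro ⟨i, j, l⟩ ht
  rw [Finset.mem_coe, Finsupp.mem_support_iff] at ht
  by_cases hl : n ∣ l
  · obtain ⟨m, rfl⟩ := hl
    exact ⟨(i, j, m), rfl⟩
  · exact absurd (H.coord_eq_zero b.2 hl) ht

/-- The invariants are the skew polynomial ring in `u`, `z`, `vⁿ`, of degrees `1`, `2`, `n`. -/
theorem isQuantumSpace (H : IsDownUpAction T k s p r q) :
    IsQuantumSpace (A := Taft.xInvariants T)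
      (inducedGrading (DownUp.grading α β) (Taft.xInvariants T)) r
      ⟨u α β, H.u_mem⟩ ⟨z α β p, H.z_mem⟩ ⟨v α β ^ n, H.v_pow_mem⟩ 1 2 n where
  lam_ne_zero := H.r_ne_zero
  y_mul_x := Subtype.ext (z_mul_u H.α_eq H.β_eq)
  w_mul_x := Subtype.ext H.v_pow_mul_u
  w_mul_y := Subtype.ext H.v_pow_mul_z
  a_pos := one_pos
  b_pos := two_pos
  c_pos := by omega
  linearIndependent := by
    refine LinearIndependent.of_comp (Taft.xInvariants T).val.toLinearMap ?_
    have : (Taft.xInvariants T).val.toLinearMap ∘ H.invariantMonomial =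
        monomial₃ (u α β) (z α β p) (v α β) ∘ stretch n :=
      funext H.coe_invariantMonomial
    change LinearIndependent 𝕜 ((Taft.xInvariants T).val.toLinearMap ∘ H.invariantMonomial)
    rw [this]
    exact (linearIndependent_monomials H.α_eq H.β_eq).comp _ (stretch_injective (by omega))
  span_eq_top := by
    intro b _
    change b ∈ Submodule.span 𝕜 (Set.range H.invariantMonomial)
    rw [← Set.image_univ, H.mem_span_invariantMonomial_iff, Set.image_univ]
    exact H.support_subset b
  piece_eq := by
    intro d
    ext b
    refine Iff.trans ?_ (H.mem_span_invariantMonomial_iff _ b).symm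
    change (b : DownUp α β) ∈ DownUp.grading α β d ↔ _
    rw [grading_eq_span H.α_eq H.β_eq, ← DownUp.coe_basis H.α_eq H.β_eq,
      Module.Basis.mem_span_image]
    change ((H.pbw.repr (b : DownUp α β)).support : Set (ℕ × ℕ × ℕ)) ⊆ _ ↔ _
    constructor
    · intro h t ht
      obtain ⟨t', rfl⟩ := H.support_subset b ht
      refine ⟨t', ?_, rfl⟩
      have : t'.1 + 2 * t'.2.1 + n * t'.2.2 = d := h ht
      simpa using this
    · intro h t ht
      obtain ⟨t', ht', rfl⟩ := h ht
      have ht' : 1 * t'.1 + 2 * t'.2.1 + n * t'.2.2 = d := ht'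
      change t'.1 + 2 * t'.2.1 + n * t'.2.2 = d
      omega

theorem xInvariants_eq_adjoin (H : IsDownUpAction T k s p r q) :
    Taft.xInvariants T = Algebra.adjoin 𝕜 {u α β, z α β p, v α β ^ n} := by
  apply le_antisymm
  · intro a ha
    have hb := H.isQuantumSpace.span_eq_top
      (Submodule.mem_top (x := (⟨a, ha⟩ : Taft.xInvariants T)))
    have hle : Submodule.span 𝕜 (Set.range H.invariantMonomial) ≤
        (Subalgebra.toSubmodule (Algebra.adjoin 𝕜 {u α β, z α β p, v α β ^ n})).comap
          (Taft.xInvariants T).val.toLinearMap := by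
      rw [Submodule.span_le]
      rintro _ ⟨t, rfl⟩
      change (H.invariantMonomial t : DownUp α β) ∈ Algebra.adjoin 𝕜 _
      rw [H.coe_invariantMonomial, monomial₃, stretch, pow_mul]
      refine mul_mem (mul_mem (pow_mem (Algebra.subset_adjoin ?_) _)
        (pow_mem (Algebra.subset_adjoin ?_) _)) (pow_mem (Algebra.subset_adjoin ?_) _) <;> simp
    exact hle hb
  · rw [Algebra.adjoin_le_iff]
    rintro _ (rfl | rfl | rfl)
    · exact H.u_mem
    · exact H.z_mem
    · exact H.v_pow_mem

end IsDownUpAction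

end TaftOnDownUp

theorem proposition5p3 {𝕜 : Type u} [Field 𝕜] [IsAlgClosed 𝕜] [CharZero 𝕜]
    (n : ℕ) (hn : 2 ≤ n) (ω sqrtω : 𝕜) (hω : IsPrimitiveRoot ω n)
    (hsqrt : sqrtω ^ 2 = ω) (hord : orderOf sqrtω = n)
    (k : ℕ) (hk : k ≤ n - 1) (q : 𝕜) (hq : q ≠ 0)
    (α β : 𝕜) (hα : α = (ω ^ (k + 1))⁻¹ * (1 + sqrtω))
    (hβ : β = -((ω ^ (2 * (k + 1)))⁻¹ * sqrtω))
    (T : HopfAction 𝕜 (Taft hn hω) (DownUp α β))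
    (hgu : T.act (Taft.g hn hω) (DownUp.u α β) = ω ^ (k + 1) • DownUp.u α β)
    (hgv : T.act (Taft.g hn hω) (DownUp.v α β) = ω ^ k • DownUp.v α β)
    (hxu : T.act (Taft.x hn hω) (DownUp.u α β) = 0)
    (hxv : T.act (Taft.x hn hω) (DownUp.v α β) = q • DownUp.u α β)
    (u v z : DownUp α β) (hu : u = DownUp.u α β) (hv : v = DownUp.v α β)
    (hz : z = v * u - (ω ^ (k + 1))⁻¹ • (u * v)) :
    Taft.xInvariants T = Algebra.adjoin 𝕜 {u, z, v ^ n} ∧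
    (v ^ n * u = u * v ^ n ∧
      z * u = ((ω ^ (k + 1))⁻¹ * sqrtω) • (u * z) ∧
      v ^ n * z = z * v ^ n) ∧
    (∃ e : SkewPolyRing
          !![1, (ω ^ (k + 1))⁻¹ * sqrtω, 1;
            ((ω ^ (k + 1))⁻¹ * sqrtω)⁻¹, 1, 1;
            1, 1, 1] ≃ₐ[𝕜] Taft.xInvariants T,
        (e (SkewPolyRing.X _ 0) : DownUp α β) = u ∧
        (e (SkewPolyRing.X _ 1) : DownUp α β) = z ∧
        (e (SkewPolyRing.X _ 2) : DownUp α β) = v ^ n) ∧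
    IsASRegular (A := Taft.xInvariants T)
      (inducedGrading (DownUp.grading α β) (Taft.xInvariants T)) := by
  have hω0 : ω ≠ 0 := hω.ne_zero (by omega)
  have H : IsDownUpAction T k sqrtω (ω ^ (k + 1))⁻¹ ((ω ^ (k + 1))⁻¹ * sqrtω) q :=
    { s_sq := hsqrt
      s_pow := by rw [← hord, pow_orderOf_eq_one]
      q_ne_zero := hq
      p_mul := inv_mul_cancel₀ (pow_ne_zero _ hω0)
      r_eq := rfl
      α_eq := by rw [hα]; ring
      β_eq := by rw [hβ, mul_comm 2, pow_mul]; ring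
      g_u := hgu
      g_v := hgv
      x_u := hxu
      x_v := hxv }
  subst hu hv
  obtain rfl : z = DownUp.z α β (ω ^ (k + 1))⁻¹ := hz
  refine ⟨H.xInvariants_eq_adjoin, ⟨H.v_pow_mul_u, DownUp.z_mul_u H.α_eq H.β_eq, H.v_pow_mul_z⟩,
    ?_, H.isQuantumSpace.isASRegular⟩
  obtain ⟨e, h0, h1, h2⟩ := H.isQuantumSpace.exists_skewPolyRing_equiv
    !![1, (ω ^ (k + 1))⁻¹ * sqrtω, 1; ((ω ^ (k + 1))⁻¹ * sqrtω)⁻¹, 1, 1; 1, 1, 1] rfl rfl rfl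
  exact ⟨e, congrArg Subtype.val h0, congrArg Subtype.val h1, congrArg Subtype.val h2⟩
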